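/- **Setting.** Let $n$ workers hold datasets of $m\ge 1$ points, $\mathcal{L}_i(\theta)=\frac1m\sum_{k=1}^m \ell(\theta,z^{(i)}_k)$ for $\theta\in\mathbb{R}^d$ (Euclidean norm), with $\ell(\cdot,z)$ differentiable for every $z$ and every $\mathcal{L}_i$ $L$-Lipschitz smooth ($\nabla\mathcal{L}_i$ is $L$-Lipschitz), $L>0$. Let $\mathcal{H}\subseteq[n]$, $|\mathcal{H}|=n-f$, be the honest workers, $\mathcal{L}_{\mathcal H}=\frac{1}{|\mathcal{H}|}\sum_{i\in\mathcal{H}}\mathcal{L}_i$, and assume $(G,B)$-gradient dissimilarity with $G>0$ and $B>0$: $$\frac{1}{|\mathcal{H}|}\sum_{i\in\mathcal{H}}\|\nabla\mathcal{L}_i(\theta)-\nabla\mathcal{L}_{\mathcal H}(\theta)\|^2\le G^2+B^2\|\nabla\mathcal{L}_{\mathcal H}(\theta)\|^2\qquad\forall\theta\in\mathbb{R}^d .$$ Let $\mathcal{L}_{\mathcal H}$ be bounded below with infimum $\mathcal{L}_{\mathcal H}^*$, let $\mathcal{L}_{\mathcal H}(\theta_1)-\mathcal{L}^*_{\mathcal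 H}\le\Delta_o$ and $\max_{i\in\mathcal{H}}\|\nabla\mathcal{L}_i(\theta_1)\|\le\zeta$. **Aggregation.** Let $\mathbf{F}=\mathbf{F}_0\circ\mathbf{NNM}$ with $\mathbf{F}_0\in\{\mathbf{CWTM},\mathbf{CWMed},\mathbf{GM},\mathbf{MK}\}$. All ties may be broken arbitrarily. $\mathbf{NNM}$ replaces every input by the average of the $n-f$ inputs closest to it (itself included). $\mathbf{CWTM}$ discards, in each coordinate, the $f$ smallest and $f$ largest values and averages the others. $\mathbf{CWMed}$ outputs a median in each coordinate. $\mathbf{GM}$ outputs a minimizer of the sum of distances to the inputs. $\mathbf{MK}$ averages, for some fixed $1\le q\le n-f$, $q$ inputs with the smallest scores, the score of an input being the sum of its squared distances to the $n-f$ inputs closest to it (itself included). $\mathbf{ARC}$ clips: $\mathbf{ARC}(x_1,\dots,x_n)=(\min(1,C/\|x_i\|)\,x_i)_{i\in[n]}$, where $C$ is the $(k+1)$-th largest of the norms $\|x_1\|,\dots,\|x_n\|$ and $k=\lfloor 2\frac fn(n-f)\rfloor$. A map $\mathbf{F}$ is $(f,\kappa)$-robust if $\|\mathbf{F}(x_1,\dots,x_n)-\bar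 x_S\|^2\le\frac{\kappa}{|S|}\sum_{i\in S}\|x_i-\bar x_S\|^2$ for all $x_1,\dots,x_n\in\mathbb{R}^d$ and all $S\subseteq[n]$ with $|S|=n-f$, where $\bar x_S=\frac1{|S|}\sum_{i\in S}x_i$. Call $\kappa$ an admissible coefficient of $\mathbf{F}$ if $\mathbf{F}$ is $(f,\kappa)$-robust and $$\kappa\le\max\Big\{\kappa',\ \tfrac{8f}{n-f}\Big(1+\big(1+\tfrac{f}{n-2f}\big)^2\Big)\Big\}\quad\text{for every }\kappa'\text{ for which }\mathbf{F}\text{ is }(f,\kappa')\text{-robust}$$ (so $\kappa$ is at most the displayed value, or is the smallest coefficient). **Algorithm.** Robust-DGD with $\mathbf{F}\circ\mathbf{ARC}$, started at $\theta_1$, iterates $\theta_{t+1}=\theta_t-\gamma\,\mathbf{F}\circ\mathbf{ARC}(g_t^{(1)},\dots,g_t^{(n)})$, $t=1,\dots,T$, where $g^{(i)}_t=\nabla\mathcal{L}_i(\theta_t)$ for $i\in\mathcal{H}$ and $g^{(j)}_t$ is arbitrary for $j\notin\mathcal{H}$. Its output is $\hat\theta=\theta_\tau$ with $\tau$ uniform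 on $\{1,\dots,T\}$. **Theorem.** Let $\xi_o,\upsilon\in(0,1)$, and put $$\mathsf{BP}=\frac1{2+B^2},\quad \varepsilon_o=\frac14\cdot\frac{G^2(f/n)}{1-(2+B^2)(f/n)},\quad \rho=\exp\Big(\frac{(2+B^2)\Delta_o}{(1-\xi_o)G^2}L\Big)\zeta,$$ $$\Psi(G,B,\rho)=640\Big(1+\frac1{B^2}\Big)^2\Big(1+\frac{B^2\rho^2}{G^2}\Big).$$ Suppose $\frac fn=(1-\xi)\,\mathsf{BP}$ with $0<\xi\le\min\{\upsilon/\Psi(G,B,\rho),\ \xi_o\}$. Then $\mathbf{F}$ has an admissible coefficient, and for every admissible coefficient $\kappa$, every integer $T\ge1$ with $T\ge\frac{\Delta_oL}{\kappa G^2}$, the step size $\gamma=\min\{\frac{\Delta_o}{\kappa G^2}\frac1T,\frac1L\}$, and all behaviours of the adversarial workers, $$\mathbb{E}\,\|\nabla\mathcal{L}_{\mathcal H}(\hat\theta)\|^2\le\upsilon\,\varepsilon_o .$$ -/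

import Mathlib

open scoped BigOperators

noncomputable section

namespace RobustDGD

/-- The parameter space `ℝ^d` with its Euclidean norm. -/
abbrev Vec (d : ℕ) : Type := EuclideanSpace ℝ (Fin d)

/-! ### Losses -/

/-- Local loss of a worker holding the data points `z₁, …, z_m`: the average point-wise loss. -/
def localLoss {d m : ℕ} {Z : Type*} (ℓ : Vec d → Z → ℝ) (z : Fin m → Z) (θ : Vec d) : ℝ :=
  (1 / (m : ℝ)) * ∑ k, ℓ θ (z k)

/-- Average loss of the workers in `H`. -/
def honestLoss {d n : ℕ} (L : Fin n → Vec d → ℝ) (H : Finset (Fin n)) (θ : Vec d) : ℝ :=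
  (1 / (H.card : ℝ)) * ∑ i ∈ H, L i θ

/-- `L`-Lipschitz smoothness: the gradient is `L`-Lipschitz. -/
def LipschitzSmooth {d : ℕ} (L : ℝ) (h : Vec d → ℝ) : Prop :=
  ∀ θ θ' : Vec d, ‖gradient h θ - gradient h θ'‖ ≤ L * ‖θ - θ'‖

/-- `(G, B)`-gradient dissimilarity of the losses `L i`, `i ∈ H`. -/
def GradientDissimilarity {d n : ℕ} (L : Fin n → Vec d → ℝ) (H : Finset (Fin n))
    (G B : ℝ) : Prop :=
  ∀ θ : Vec d,
    (1 / (H.card : ℝ)) * ∑ i ∈ H, ‖gradient (L i) θ - gradient (honestLoss L H) θ‖ ^ 2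
      ≤ G ^ 2 + B ^ 2 * ‖gradient (honestLoss L H) θ‖ ^ 2

/-! ### Aggregation rules -/

/-- An aggregation method for `n` vectors of `ℝ^d`. -/
abbrev Aggregator (n d : ℕ) : Type := (Fin n → Vec d) → Vec d

/-- Average of the vectors indexed by `S`. -/
def mean {d n : ℕ} (S : Finset (Fin n)) (x : Fin n → Vec d) : Vec d :=
  (1 / (S.card : ℝ)) • ∑ i ∈ S, x i

/-- The `(k+1)`-th smallest of the `n` reals `v 0, …, v (n-1)` (with multiplicity); `0` if
`n ≤ k`. -/
def orderStat {n : ℕ} (v : Fin n → ℝ) (k : ℕ) : ℝ :=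
  if h : k < n then v (Tuple.sort v ⟨k, h⟩) else 0

/-- `F` is the coordinate-wise trimmed mean: in each coordinate, the `f` smallest and the `f`
largest values are discarded and the remaining `n - 2f` values are averaged. -/
def IsCWTM {n d : ℕ} (f : ℕ) (F : Aggregator n d) : Prop :=
  ∀ (x : Fin n → Vec d) (j : Fin d),
    F x j = (1 / ((n : ℝ) - 2 * f)) * ∑ k ∈ Finset.Ico f (n - f), orderStat (fun i => x i j) k

/-- `F` is a coordinate-wise median: each coordinate of the output is a median of the inputs in
this coordinate. For even `n`, any value between the two middle values is allowed, in particular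
their midpoint. -/
def IsCWMed {n d : ℕ} (F : Aggregator n d) : Prop :=
  ∀ (x : Fin n → Vec d) (j : Fin d),
    orderStat (fun i => x i j) ((n - 1) / 2) ≤ F x j ∧
      F x j ≤ orderStat (fun i => x i j) (n / 2)

/-- `F` is a geometric median: it outputs a minimizer of the sum of distances to the inputs. -/
def IsGM {n d : ℕ} (F : Aggregator n d) : Prop :=
  ∀ (x : Fin n → Vec d) (y : Vec d), ∑ i, ‖F x - x i‖ ≤ ∑ i, ‖y - x i‖

/-- Multi-Krum score of `x i`: the sum of its squared distances to the `n - f` inputs closest to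
it (itself included, that is, to the `n - f - 1` closest other inputs). -/
def krumScore {n d : ℕ} (f : ℕ) (x : Fin n → Vec d) (i : Fin n) : ℝ :=
  ∑ k ∈ Finset.range (n - f), orderStat (fun j => ‖x i - x j‖ ^ 2) k

/-- `F` is a Multi-Krum rule: for some `1 ≤ q ≤ n - f` it averages `q` inputs with the smallest
scores, ties being broken in any way. -/
def IsMultiKrum {n d : ℕ} (f : ℕ) (F : Aggregator n d) : Prop :=
  ∃ q : ℕ, 1 ≤ q ∧ q ≤ n - f ∧
    ∀ x : Fin n → Vec d, ∃ M : Finset (Fin n), M.card = q ∧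
      (∀ i ∈ M, ∀ j ∉ M, krumScore f x i ≤ krumScore f x j) ∧ F x = mean M x

/-- `N` is nearest-neighbor mixing: each input is replaced by the average of the `n - f` inputs
closest to it (itself included), ties being broken in any way. -/
def IsNNM {n d : ℕ} (f : ℕ) (N : (Fin n → Vec d) → Fin n → Vec d) : Prop :=
  ∀ (x : Fin n → Vec d) (i : Fin n), ∃ A : Finset (Fin n), A.card = n - f ∧
    (∀ j ∈ A, ∀ k ∉ A, ‖x j - x i‖ ≤ ‖x k - x i‖) ∧ N x i = mean A x

/-- `A ∈ {CWTM, CWMed, GM, MK} ∘ NNM`. -/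
def IsRuleWithNNM {n d : ℕ} (f : ℕ) (A : Aggregator n d) : Prop :=
  ∃ (F : Aggregator n d) (N : (Fin n → Vec d) → Fin n → Vec d),
    (IsCWTM f F ∨ IsCWMed F ∨ IsGM F ∨ IsMultiKrum f F) ∧ IsNNM f N ∧ A = F ∘ N

/-- `clip_C(x) = min(1, C / ‖x‖) x`. -/
def clip {d : ℕ} (C : ℝ) (x : Vec d) : Vec d := min 1 (C / ‖x‖) • x

/-- Adaptive robust clipping: with `k = ⌊2 (f/n) (n - f)⌋`, every vector is clipped at the
`(k+1)`-th largest norm, that is, the norm at position `n - 1 - k` (counted from `0`) in increasing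
order. -/
def arc {n d : ℕ} (f : ℕ) (x : Fin n → Vec d) : Fin n → Vec d :=
  let k : ℕ := ⌊2 * ((f : ℝ) / n) * ((n : ℝ) - f)⌋₊
  let C : ℝ := orderStat (fun i => ‖x i‖) (n - 1 - k)
  fun i => clip C (x i)

/-! ### Robustness -/

/-- `(f, κ)`-robustness of an aggregation method. -/
def IsRobust {n d : ℕ} (f : ℕ) (κ : ℝ) (F : Aggregator n d) : Prop :=
  ∀ (x : Fin n → Vec d) (S : Finset (Fin n)), S.card + f = n →
    ‖F x - mean S x‖ ^ 2 ≤ κ / (S.card : ℝ) * ∑ i ∈ S, ‖x i - mean S x‖ ^ 2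

/-- The reference value `(8 f / (n - f)) (1 + (1 + f / (n - 2f))²)` for the robustness coefficient
of the rules composed with nearest-neighbor mixing. -/
def coefficientBound (n f : ℕ) : ℝ :=
  8 * (f : ℝ) / ((n : ℝ) - f) * (1 + (1 + (f : ℝ) / ((n : ℝ) - 2 * f)) ^ 2)

/-- `κ` is a robustness coefficient of `F` that is at most the reference value, or at most as large
as every other robustness coefficient of `F`. (Robustness is monotone in `κ`, so some upper
bound is part of the choice of `κ`. The smallest robustness coefficient always qualifies; so does
each robustness coefficient up to the reference value.) -/
def IsRobustnessCoefficient {n d : ℕ} (f : ℕ) (κ : ℝ) (F : Aggregator n d) : Prop :=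
  IsRobust f κ F ∧ ∀ κ' : ℝ, IsRobust f κ' F → κ ≤ max κ' (coefficientBound n f)

/-! ### Robust distributed gradient descent -/

/-- `θ 1, …, θ (T+1)` are the models and `g t i` the vectors received from worker `i` in step `t` of
an execution of Robust-DGD with aggregation `A`, learning rate `γ` and honest workers `H`. The
vectors `g t i`, `i ∉ H`, sent by adversarial workers are arbitrary. -/
def IsExecution {n d : ℕ} (L : Fin n → Vec d → ℝ) (H : Finset (Fin n)) (A : Aggregator n d)
    (γ : ℝ) (T : ℕ) (θ : ℕ → Vec d) (g : ℕ → Fin n → Vec d) : Prop :=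
  ∀ t ∈ Finset.Icc 1 T,
    (∀ i ∈ H, g t i = gradient (L i) (θ t)) ∧ θ (t + 1) = θ t - γ • A (g t)

/-- Expectation of `φ(θ̂)`, where `θ̂ = θ τ` with `τ` uniform on `{1, …, T}`. -/
def expectOutput {d : ℕ} (T : ℕ) (θ : ℕ → Vec d) (φ : Vec d → ℝ) : ℝ :=
  ∫ τ, φ (θ τ) ∂(ProbabilityTheory.uniformOn (Set.Icc 1 T))

/-! ### Constants -/

/-- The breakdown point `1 / (2 + B²)`. -/
def breakdownPoint (B : ℝ) : ℝ := 1 / (2 + B ^ 2)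

/-- The lower bound `ε_o` on the stationarity error, for the fraction `a = f / n`. -/
def lowerBound (G B a : ℝ) : ℝ := 1 / 4 * (G ^ 2 * a / (1 - (2 + B ^ 2) * a))

/-- `Ψ(G, B, ρ)`. -/
def Psi (G B ρ : ℝ) : ℝ := 640 * (1 + 1 / B ^ 2) ^ 2 * (1 + B ^ 2 * ρ ^ 2 / G ^ 2)

/-- `ρ = exp((2 + B²) Δ_o L / ((1 - ξ_o) G²)) ζ`. -/
def rhoConst (G B L Δ₀ ξ₀ ζ : ℝ) : ℝ :=
  Real.exp ((2 + B ^ 2) * Δ₀ / ((1 - ξ₀) * G ^ 2) * L) * ζ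

end RobustDGD

end

/-!
Each of the four rules moves its output away from an arbitrary point `u` by at most a constant times
the second moment of the honest inputs about `u` (`HasDeviationBound`): trimming and medians because
extreme dishonest values are compensated by honest ones, the geometric median because at a minimizer
the honest unit vectors must be balanced by `f` dishonest ones, Multi-Krum because a small score
forces proximity to `n - 2f` honest inputs. Nearest-neighbor mixing contracts the honest inputs
towards their average (`IsNNM.sum_norm_sub_mean_sq_le`). Together this gives a robustness coefficient
`48 r` with `r = f / (n - 2f)` (`IsRuleWithNNM.isRobust`), while every coefficient is at least `r`
(`IsRobust.le_coefficient`). An admissible coefficient therefore exists and is at most the larger of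
`48 r` and the reference value.

Adaptive clipping is a projection onto a ball. By firm nonexpansiveness the variance of the honest
inputs splits into the variance of the clipped inputs and that of the displacements; since few inputs
are clipped, the latter pays for the bias, and clipping adds only `2 r` to the coefficient
(`IsRobust.comp_arc`). As more than `f` inputs have norm at least the clipping threshold, that
threshold is at most the largest honest norm.

A `κ`-robust rule outputs a vector of norm at most `√(1 + κ)` times the clipping threshold
(`IsRobust.norm_le`). Coordinate-wise rules can exceed the threshold itself, so some such factor is
needed. The honest gradients grow at most by `1 + γ L √(1 + κ)` in each step, and
`√(1 + κ) / κ ≤ 1 / r + 2 = n / f ≤ (2 + B²) / (1 - ξ₀)` keeps all of them below `ρ`.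

Descent with an inexact gradient (`LipschitzSmooth.sum_norm_gradient_sq_le`) bounds the mean of
`‖∇L_H‖²` by `2 κ G² + (κ + 2 r) (G² + B² ρ²)`, which is at most
`160 (f / n) (1 + 1 / B²)² (G² + B² ρ²)` (`three_mul_coefficient_le`). The assumption on `ξ` says that
this is at most `υ ε_o` (`error_le_mul_lowerBound`).
-/

noncomputable section

namespace RobustDGD

/-! ### Averages and variances -/

variable {d n f : ℕ}

lemma card_smul_mean {S : Finset (Fin n)} (hS : S.Nonempty) (x : Fin n → Vec d) :
    (S.card : ℝ) • mean S x = ∑ i ∈ S, x i := by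
  have : (S.card : ℝ) ≠ 0 := by exact_mod_cast hS.card_pos.ne'
  rw [mean, smul_smul, mul_one_div_cancel this, one_smul]

lemma mean_sub (S : Finset (Fin n)) (x y : Fin n → Vec d) :
    mean S (fun i => x i - y i) = mean S x - mean S y := by
  simp [mean, Finset.sum_sub_distrib, smul_sub]

lemma norm_mean_le {S : Finset (Fin n)} {x : Fin n → Vec d} {c : ℝ} (hc : 0 ≤ c)
    (hx : ∀ i ∈ S, ‖x i‖ ≤ c) : ‖mean S x‖ ≤ c := by
  rcases S.eq_empty_or_nonempty with rfl | hS
  · simpa [mean] using hc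
  have h0 : (0 : ℝ) < S.card := by exact_mod_cast hS.card_pos
  rw [mean, norm_smul, Real.norm_of_nonneg (by positivity), one_div, inv_mul_le_iff₀ h0]
  exact (norm_sum_le _ _).trans ((Finset.sum_le_sum hx).trans (by simp))

/-- Decomposition of the second moment about `u` into variance and squared bias. -/
lemma sum_norm_sub_sq_eq (S : Finset (Fin n)) (x : Fin n → Vec d) (u : Vec d) :
    ∑ i ∈ S, ‖x i - u‖ ^ 2
      = ∑ i ∈ S, ‖x i - mean S x‖ ^ 2 + (S.card : ℝ) * ‖mean S x - u‖ ^ 2 := by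
  rcases S.eq_empty_or_nonempty with rfl | hS
  · simp
  have key : ∑ i ∈ S, inner ℝ (x i - mean S x) (mean S x - u) = 0 := by
    rw [← sum_inner, Finset.sum_sub_distrib, ← card_smul_mean hS]
    simp [← Nat.cast_smul_eq_nsmul ℝ]
  have h : ∀ i ∈ S, ‖x i - u‖ ^ 2 = ‖x i - mean S x‖ ^ 2
      + 2 * inner ℝ (x i - mean S x) (mean S x - u) + ‖mean S x - u‖ ^ 2 := by
    intro i _
    rw [← norm_add_sq_real]
    congr 2
    abel
  rw [Finset.sum_congr rfl h, Finset.sum_add_distrib, Finset.sum_add_distrib, ← Finset.mul_sum,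
    key]
  simp

lemma sum_norm_sub_mean_sq_le (S : Finset (Fin n)) (x : Fin n → Vec d) (u : Vec d) :
    ∑ i ∈ S, ‖x i - mean S x‖ ^ 2 ≤ ∑ i ∈ S, ‖x i - u‖ ^ 2 := by
  rw [sum_norm_sub_sq_eq S x u]
  have : 0 ≤ (S.card : ℝ) * ‖mean S x - u‖ ^ 2 := by positivity
  linarith

lemma card_mul_norm_mean_sub_sq_le (S : Finset (Fin n)) (x : Fin n → Vec d) (u : Vec d) :
    (S.card : ℝ) * ‖mean S x - u‖ ^ 2 ≤ ∑ i ∈ S, ‖x i - u‖ ^ 2 := by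
  rw [sum_norm_sub_sq_eq S x u]
  have : 0 ≤ ∑ i ∈ S, ‖x i - mean S x‖ ^ 2 := by positivity
  linarith

lemma sum_norm_sub_mean_sq (S : Finset (Fin n)) (x : Fin n → Vec d) :
    ∑ i ∈ S, ‖x i - mean S x‖ ^ 2 = ∑ i ∈ S, ‖x i‖ ^ 2 - (S.card : ℝ) * ‖mean S x‖ ^ 2 := by
  have := sum_norm_sub_sq_eq S x 0
  simp only [sub_zero] at this
  linarith

lemma sum_sum_norm_sub_sq (S : Finset (Fin n)) (x : Fin n → Vec d) :
    ∑ i ∈ S, ∑ j ∈ S, ‖x i - x j‖ ^ 2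
      = 2 * (S.card : ℝ) * ∑ i ∈ S, ‖x i - mean S x‖ ^ 2 := by
  rw [Finset.sum_comm]
  rw [Finset.sum_congr rfl fun j _ => sum_norm_sub_sq_eq S x (x j)]
  rw [Finset.sum_add_distrib, ← Finset.mul_sum]
  simp only [Finset.sum_const, nsmul_eq_mul, norm_sub_rev (mean S x)]
  ring

/-! ### Selecting the smallest values -/

/-- The average of `v` over a set `A` of smallest values is at most its average over any set that has
at least as many elements. -/
lemma card_mul_sum_le_card_mul_sum {ι : Type*} [DecidableEq ι] {A S : Finset ι} {v : ι → ℝ}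
    (hcard : A.card ≤ S.card) (hA : ∀ i ∈ A, ∀ j ∉ A, v i ≤ v j) :
    (S.card : ℝ) * ∑ i ∈ A, v i ≤ (A.card : ℝ) * ∑ i ∈ S, v i := by
  rcases A.eq_empty_or_nonempty with rfl | hne
  · simp
  -- The maximum `c` of `v` on `A` is a threshold: `v - c` is nonpositive on `A`, nonnegative off it.
  obtain ⟨m, hm, hmax⟩ := A.exists_max_image v hne
  have h1 : ∑ i ∈ A, (v i - v m) ≤ ∑ i ∈ S, (v i - v m) := by
    calc ∑ i ∈ A, (v i - v m) ≤ ∑ i ∈ A ∩ S, (v i - v m) := by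
          rw [← Finset.sum_inter_add_sum_sdiff A S]
          have : ∑ i ∈ A \ S, (v i - v m) ≤ 0 := Finset.sum_nonpos fun i hi => by
            linarith [hmax i (Finset.mem_sdiff.1 hi).1]
          linarith
      _ = ∑ i ∈ S ∩ A, (v i - v m) := by rw [Finset.inter_comm]
      _ ≤ ∑ i ∈ S, (v i - v m) := by
          rw [← Finset.sum_inter_add_sum_sdiff S A]
          have : 0 ≤ ∑ i ∈ S \ A, (v i - v m) := Finset.sum_nonneg fun i hi => by
            linarith [hA m hm i (Finset.mem_sdiff.1 hi).2]
          linarith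
  have h2 : ∑ i ∈ A, v i ≤ A.card * v m := by
    simpa using Finset.sum_le_sum hmax
  simp only [Finset.sum_sub_distrib, Finset.sum_const, nsmul_eq_mul] at h1
  have hc : (A.card : ℝ) ≤ S.card := by exact_mod_cast hcard
  have hA0 : (0 : ℝ) ≤ A.card := by positivity
  nlinarith [mul_le_mul_of_nonneg_left h1 hA0, mul_le_mul_of_nonneg_left h2 (sub_nonneg.2 hc)]

lemma sum_le_sum_of_forall_le {ι : Type*} [DecidableEq ι] {A S : Finset ι} {v : ι → ℝ}
    (hcard : A.card = S.card) (hA : ∀ i ∈ A, ∀ j ∉ A, v i ≤ v j) :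
    ∑ i ∈ A, v i ≤ ∑ i ∈ S, v i := by
  rcases S.eq_empty_or_nonempty with rfl | hS
  · simp [Finset.card_eq_zero.1 hcard]
  have h := card_mul_sum_le_card_mul_sum hcard.le hA
  rw [hcard] at h
  have h0 : (0 : ℝ) < S.card := by exact_mod_cast hS.card_pos
  exact le_of_mul_le_mul_left h h0

/-- A set of inputs meets the set `S` of honest inputs in all but at most `f` of its elements. -/
lemma card_le_card_inter_add {S : Finset (Fin n)} (hS : S.card + f = n)
    (A : Finset (Fin n)) : A.card ≤ (A ∩ S).card + f := by
  have h1 := Finset.card_inter_add_card_sdiff A S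
  have h2 : (A \ S).card ≤ (Sᶜ).card := Finset.card_le_card fun i hi => by simp_all
  rw [Finset.card_compl, Fintype.card_fin] at h2
  omega

/-! ### Order statistics -/

/-- Position of the index `i` in the increasing arrangement of `v`, counted from `0`. -/
def rank (v : Fin n → ℝ) (i : Fin n) : ℕ := ((Tuple.sort v).symm i : ℕ)

/-- The indices whose position in the increasing arrangement of `v` lies in `[a, b)`. -/
def rankBlock (v : Fin n → ℝ) (a b : ℕ) : Finset (Fin n) :=
  Finset.univ.filter fun i => rank v i ∈ Finset.Ico a b

lemma mem_rankBlock {v : Fin n → ℝ} {a b : ℕ} {i : Fin n} :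
    i ∈ rankBlock v a b ↔ a ≤ rank v i ∧ rank v i < b := by
  simp [rankBlock]

lemma rank_lt (v : Fin n → ℝ) (i : Fin n) : rank v i < n := ((Tuple.sort v).symm i).2

lemma orderStat_rank (v : Fin n → ℝ) (i : Fin n) : orderStat v (rank v i) = v i := by
  simp [orderStat, rank]

lemma orderStat_mono {v : Fin n → ℝ} {k l : ℕ} (h : k ≤ l) (hl : l < n) :
    orderStat v k ≤ orderStat v l := by
  rw [orderStat, orderStat, dif_pos (h.trans_lt hl), dif_pos hl]
  exact Tuple.monotone_sort v (show (⟨k, _⟩ : Fin n) ≤ ⟨l, _⟩ from h)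

lemma le_of_rank_le {v : Fin n → ℝ} {i j : Fin n} (h : rank v i ≤ rank v j) : v i ≤ v j := by
  rw [← orderStat_rank v i, ← orderStat_rank v j]
  exact orderStat_mono h (rank_lt v j)

lemma sum_orderStat (v : Fin n → ℝ) (φ : ℝ → ℝ) (a : ℕ) {b : ℕ} (hb : b ≤ n) :
    ∑ k ∈ Finset.Ico a b, φ (orderStat v k) = ∑ i ∈ rankBlock v a b, φ (v i) := by
  symm
  refine Finset.sum_nbij (rank v) ?_ ?_ ?_ ?_
  · intro i hi
    simpa [mem_rankBlock] using hi
  · intro i _ j _ h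
    exact (Tuple.sort v).symm.injective (Fin.ext h)
  · intro k hk
    have hk' := Finset.mem_Ico.1 (Finset.mem_coe.1 hk)
    have hr : rank v (Tuple.sort v ⟨k, hk'.2.trans_le hb⟩) = k := by simp [rank]
    exact ⟨_, Finset.mem_coe.2 (mem_rankBlock.2 (by rw [hr]; exact hk')), hr⟩
  · intro i _
    rw [orderStat_rank]

lemma card_rankBlock (v : Fin n → ℝ) (a : ℕ) {b : ℕ} (hb : b ≤ n) :
    (rankBlock v a b).card = b - a := by
  have h := sum_orderStat v (fun _ => (1 : ℝ)) a hb
  simp only [Finset.sum_const, nsmul_eq_mul, mul_one, Nat.card_Ico] at h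
  exact_mod_cast h.symm

lemma sum_orderStat_le {v : Fin n → ℝ} {S : Finset (Fin n)} :
    ∑ k ∈ Finset.range S.card, orderStat v k ≤ ∑ i ∈ S, v i := by
  have hS : S.card ≤ n := by simpa using S.card_le_univ
  rw [Finset.range_eq_Ico, sum_orderStat v (fun t => t) 0 hS]
  refine sum_le_sum_of_forall_le (by simp [card_rankBlock v 0 hS]) fun i hi j hj => ?_
  simp only [mem_rankBlock, zero_le, true_and, not_lt] at hi hj
  exact le_of_rank_le (hi.le.trans hj)

/-! ### Deviation bounds for the four rules -/

/-- The squared distance of `F y` to every reference point `u` (not only to the honest average) is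
at most `6 / (n - 2f)` times the second moment of the honest inputs about `u`. The freedom in `u`
makes the property composable with pre-aggregation. The constant `6` is the one that Multi-Krum needs;
it is not sharp for the other rules. -/
def HasDeviationBound (f : ℕ) (F : Aggregator n d) : Prop :=
  ∀ (y : Fin n → Vec d) (S : Finset (Fin n)) (u : Vec d), S.card + f = n →
    ((n : ℝ) - 2 * f) * ‖F y - u‖ ^ 2 ≤ 6 * ∑ i ∈ S, ‖y i - u‖ ^ 2

/-- A deviation bound can be checked coordinate by coordinate. -/
lemma hasDeviationBound_of_coordinates {F : Aggregator n d}
    (h : ∀ (y : Fin n → Vec d) (S : Finset (Fin n)) (u : Vec d) (j : Fin d), S.card + f = n →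
      ((n : ℝ) - 2 * f) * (F y j - u j) ^ 2 ≤ 6 * ∑ i ∈ S, (y i j - u j) ^ 2) :
    HasDeviationBound f F := by
  intro y S u hS
  simp only [EuclideanSpace.real_norm_sq_eq, PiLp.sub_apply]
  rw [Finset.sum_comm, Finset.mul_sum, Finset.mul_sum]
  exact Finset.sum_le_sum fun j _ => h y S u j hS

/-- At most `f` elements of `A` are dishonest, so at least `#A - f` honest values are as far from `u`
as `a` is. -/
lemma mul_sq_le_sum_of_block {S A : Finset (Fin n)} (hS : S.card + f = n) {v : Fin n → ℝ} {a u : ℝ}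
    (h : ∀ i ∈ A, (a - u) ^ 2 ≤ (v i - u) ^ 2) :
    ((A.card : ℝ) - f) * (a - u) ^ 2 ≤ ∑ i ∈ S, (v i - u) ^ 2 := by
  have hc : (A.card : ℝ) ≤ (A ∩ S).card + f := by exact_mod_cast card_le_card_inter_add hS A
  calc ((A.card : ℝ) - f) * (a - u) ^ 2 ≤ (A ∩ S).card * (a - u) ^ 2 :=
        mul_le_mul_of_nonneg_right (by linarith) (sq_nonneg _)
    _ = ∑ _i ∈ A ∩ S, (a - u) ^ 2 := by simp
    _ ≤ ∑ i ∈ A ∩ S, (v i - u) ^ 2 :=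
        Finset.sum_le_sum fun i hi => h i (Finset.mem_inter.1 hi).1
    _ ≤ ∑ i ∈ S, (v i - u) ^ 2 :=
        Finset.sum_le_sum_of_subset_of_nonneg Finset.inter_subset_right fun _ _ _ => sq_nonneg _

lemma IsCWMed.hasDeviationBound {F : Aggregator n d} (hF : IsCWMed F) (hfn : 2 * f < n) :
    HasDeviationBound f F := by
  refine hasDeviationBound_of_coordinates fun y S u j hS => ?_
  set v : Fin n → ℝ := fun i => y i j with hv
  obtain ⟨h1, h2⟩ := hF y j
  have hsum : 0 ≤ ∑ i ∈ S, (v i - u j) ^ 2 := Finset.sum_nonneg fun _ _ => sq_nonneg _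
  -- At least half of the values lie on the far side of the median, as seen from `u`.
  obtain ⟨A, hA, hfar⟩ : ∃ A : Finset (Fin n), (n : ℝ) / 2 ≤ A.card ∧
      ∀ i ∈ A, (F y j - u j) ^ 2 ≤ (v i - u j) ^ 2 := by
    rcases le_total (u j) (F y j) with hu | hu
    · refine ⟨rankBlock v (n / 2) n, ?_, fun i hi => ?_⟩
      · rw [card_rankBlock v _ le_rfl, div_le_iff₀ two_pos]
        norm_cast
        omega
      · have := orderStat_mono (v := v) (mem_rankBlock.1 hi).1 (rank_lt v i)
        rw [orderStat_rank] at this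
        exact pow_le_pow_left₀ (by linarith) (by linarith) 2
    · have hb : (n - 1) / 2 + 1 ≤ n := by omega
      refine ⟨rankBlock v 0 ((n - 1) / 2 + 1), ?_, fun i hi => ?_⟩
      · rw [card_rankBlock v _ hb, div_le_iff₀ two_pos]
        norm_cast
        omega
      · have := orderStat_mono (v := v) (Nat.lt_succ_iff.1 (mem_rankBlock.1 hi).2) (by omega)
        rw [orderStat_rank] at this
        rw [← neg_sq (F y j - u j), ← neg_sq (v i - u j)]
        exact pow_le_pow_left₀ (by linarith) (by linarith) 2
  have h := mul_sq_le_sum_of_block hS hfar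
  nlinarith [mul_le_mul_of_nonneg_right hA (sq_nonneg (F y j - u j))]

/-- A monotone transform of the values has, over any `f` indices, at most the sum that it has
over the `f` largest entries. -/
lemma sum_le_sum_rankBlock_top {v : Fin n → ℝ} {φ : ℝ → ℝ} (hφ : Monotone φ) (hf : f ≤ n)
    {D : Finset (Fin n)} (hD : D.card = f) :
    ∑ i ∈ D, φ (v i) ≤ ∑ i ∈ rankBlock v (n - f) n, φ (v i) := by
  have h := sum_le_sum_of_forall_le (A := rankBlock v (n - f) n) (S := D)
    (v := fun i => -φ (v i)) (by rw [card_rankBlock v _ le_rfl, hD]; omega) fun i hi j hj => by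
      have hj' : rank v j < n - f := by
        by_contra hcon
        exact hj (mem_rankBlock.2 ⟨by omega, rank_lt v j⟩)
      exact neg_le_neg (hφ (le_of_rank_le (hj'.le.trans (mem_rankBlock.1 hi).1)))
  simpa using h

lemma sum_le_sum_rankBlock_bot {v : Fin n → ℝ} {φ : ℝ → ℝ} (hφ : Antitone φ) (hf : f ≤ n)
    {D : Finset (Fin n)} (hD : D.card = f) :
    ∑ i ∈ D, φ (v i) ≤ ∑ i ∈ rankBlock v 0 f, φ (v i) := by
  have h := sum_le_sum_of_forall_le (A := rankBlock v 0 f) (S := D)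
    (v := fun i => -φ (v i)) (by rw [card_rankBlock v _ hf, hD]; omega) fun i hi j hj => by
      have hj' : f ≤ rank v j := by
        by_contra hcon
        exact hj (mem_rankBlock.2 ⟨zero_le, by omega⟩)
      exact neg_le_neg (hφ (le_of_rank_le ((mem_rankBlock.1 hi).2.le.trans hj')))
  simpa using h

/-- The values that survive trimming have at most the second moment of the honest values, about
any point: the `f` dishonest values above (below) `u` are no further from `u` than the `f` largest
(smallest) values. -/
lemma sum_trimmed_sq_le {S : Finset (Fin n)} (hS : S.card + f = n) (hfn : 2 * f < n)
    (v : Fin n → ℝ) (u : ℝ) :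
    ∑ k ∈ Finset.Ico f (n - f), (orderStat v k - u) ^ 2 ≤ ∑ i ∈ S, (v i - u) ^ 2 := by
  have hD : (Sᶜ).card = f := by rw [Finset.card_compl, Fintype.card_fin]; omega
  have hsplit : ∀ t : ℝ, (t - u) ^ 2 = (max (t - u) 0) ^ 2 + (max (u - t) 0) ^ 2 := by
    intro t
    rcases le_total t u with h | h
    · rw [max_eq_right (by linarith : t - u ≤ 0), max_eq_left (by linarith : 0 ≤ u - t)]; ring
    · rw [max_eq_left (by linarith : 0 ≤ t - u), max_eq_right (by linarith : u - t ≤ 0)]; ring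
  have htop := sum_le_sum_rankBlock_top (v := v) (φ := fun t => (max (t - u) 0) ^ 2)
    (fun a b hab => pow_le_pow_left₀ (le_max_right _ _)
      (max_le_max_right 0 (by linarith)) 2) (by omega : f ≤ n) hD
  have hbot := sum_le_sum_rankBlock_bot (v := v) (φ := fun t => (max (u - t) 0) ^ 2)
    (fun a b hab => pow_le_pow_left₀ (le_max_right _ _)
      (max_le_max_right 0 (by linarith)) 2) (by omega : f ≤ n) hD
  have htop' : ∑ i ∈ rankBlock v (n - f) n, (max (v i - u) 0) ^ 2
      ≤ ∑ i ∈ rankBlock v (n - f) n, (v i - u) ^ 2 :=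
    Finset.sum_le_sum fun i _ => by rw [hsplit]; nlinarith [sq_nonneg (max (u - v i) 0)]
  have hbot' : ∑ i ∈ rankBlock v 0 f, (max (u - v i) 0) ^ 2
      ≤ ∑ i ∈ rankBlock v 0 f, (v i - u) ^ 2 :=
    Finset.sum_le_sum fun i _ => by rw [hsplit]; nlinarith [sq_nonneg (max (v i - u) 0)]
  have hdis : ∑ i ∈ Sᶜ, (v i - u) ^ 2
      = ∑ i ∈ Sᶜ, (max (v i - u) 0) ^ 2 + ∑ i ∈ Sᶜ, (max (u - v i) 0) ^ 2 := by
    rw [← Finset.sum_add_distrib]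
    exact Finset.sum_congr rfl fun i _ => hsplit _
  have hall := Finset.sum_add_sum_compl S fun i => (v i - u) ^ 2
  have hfull : ∑ i, (v i - u) ^ 2 = ∑ k ∈ Finset.Ico 0 n, (orderStat v k - u) ^ 2 := by
    rw [sum_orderStat v (fun t => (t - u) ^ 2) 0 le_rfl]
    refine Finset.sum_congr ?_ fun _ _ => rfl
    ext i
    simp [mem_rankBlock, rank_lt]
  rw [← Finset.sum_Ico_consecutive _ (Nat.zero_le f) (by omega : f ≤ n),
    ← Finset.sum_Ico_consecutive _ (by omega : f ≤ n - f) (Nat.sub_le n f),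
    sum_orderStat v (fun t => (t - u) ^ 2) 0 (by omega : f ≤ n),
    sum_orderStat v (fun t => (t - u) ^ 2) (n - f) le_rfl] at hfull
  linarith

lemma IsCWTM.hasDeviationBound {F : Aggregator n d} (hF : IsCWTM f F) (hfn : 2 * f < n) :
    HasDeviationBound f F := by
  refine hasDeviationBound_of_coordinates fun y S u j hS => ?_
  have h := sum_trimmed_sq_le hS hfn (fun i => y i j) (u j)
  have hsum : 0 ≤ ∑ i ∈ S, (y i j - u j) ^ 2 := Finset.sum_nonneg fun _ _ => sq_nonneg _
  have hN : (0 : ℝ) < (n : ℝ) - 2 * f := by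
    have : (2 * f : ℝ) < n := by exact_mod_cast hfn
    linarith
  have hcard : ((Finset.Ico f (n - f)).card : ℝ) = (n : ℝ) - 2 * f := by
    rw [Nat.card_Ico, Nat.sub_sub, ← two_mul, Nat.cast_sub hfn.le]
    push_cast
    ring
  have hdev : ((n : ℝ) - 2 * f) * (F y j - u j)
      = ∑ k ∈ Finset.Ico f (n - f), (orderStat (fun i => y i j) k - u j) := by
    rw [Finset.sum_sub_distrib, Finset.sum_const, nsmul_eq_mul, hcard, hF y j]
    field_simp
  have hcs := sq_sum_le_card_mul_sum_sq (s := Finset.Ico f (n - f))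
    (f := fun k => orderStat (fun i => y i j) k - u j)
  rw [← hdev, hcard, mul_pow, sq, mul_assoc] at hcs
  have := le_of_mul_le_mul_left hcs hN
  linarith

/-- Convexity of the norm, in the direction `a`: the slope of the norm at `w` is `‖a‖` times the
cosine of the angle between `a` and `w`, and this cosine is at least `1 - 2 ‖a - w‖² / ‖a‖²`. -/
lemma norm_add_smul_sub_norm_ge {a w : Vec d} (ha : a ≠ 0) {t : ℝ} (ht : 0 ≤ t) :
    t * (‖a‖ - 2 * ‖a - w‖ ^ 2 / ‖a‖) ≤ ‖w + t • a‖ - ‖w‖ := by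
  have hα : 0 < ‖a‖ := norm_pos_iff.2 ha
  rcases eq_or_ne w 0 with rfl | hw
  · have : ‖a‖ - 2 * ‖a - 0‖ ^ 2 / ‖a‖ = -‖a‖ := by
      rw [sub_zero]; field_simp; ring
    rw [this, zero_add, norm_smul, Real.norm_of_nonneg ht, norm_zero]
    nlinarith [mul_nonneg ht hα.le]
  have hω : 0 < ‖w‖ := norm_pos_iff.2 hw
  set p : ℝ := inner ℝ a w with hp
  have hslope : ‖w‖ * (‖a‖ ^ 2 - 2 * ‖a - w‖ ^ 2) ≤ p * ‖a‖ := by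
    have hup : p ≤ ‖a‖ * ‖w‖ := real_inner_le_norm a w
    have hlow : -(‖a‖ * ‖w‖) ≤ p := neg_le_of_abs_le (abs_real_inner_le_norm a w)
    rw [norm_sub_sq_real, ← hp]
    -- The claim is affine in `p`, so it is enough to check it at `p = ± ‖a‖ ‖w‖`.
    rcases le_total (4 * ‖w‖) ‖a‖ with h | h
    · nlinarith [mul_le_mul_of_nonneg_right hlow (sub_nonneg.2 h), pow_pos hω 3,
        mul_pos hα (pow_pos hω 2)]
    · nlinarith [mul_le_mul_of_nonneg_right hup (sub_nonneg.2 h),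
        mul_nonneg hω.le (sq_nonneg (‖a‖ - ‖w‖))]
  have hcs : ‖w‖ ^ 2 + t * p ≤ ‖w + t • a‖ * ‖w‖ := by
    have := real_inner_le_norm (w + t • a) w
    rwa [inner_add_left, real_inner_self_eq_norm_sq, real_inner_smul_left] at this
  have hq : ‖a‖ - 2 * ‖a - w‖ ^ 2 / ‖a‖ = (‖a‖ ^ 2 - 2 * ‖a - w‖ ^ 2) / ‖a‖ := by
    field_simp
  rw [hq]
  have h1 : (‖a‖ ^ 2 - 2 * ‖a - w‖ ^ 2) / ‖a‖ ≤ p / ‖w‖ := by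
    rw [div_le_div_iff₀ hα hω]
    linarith
  refine (mul_le_mul_of_nonneg_left h1 ht).trans ?_
  rw [← mul_div_assoc, div_le_iff₀ hω]
  nlinarith

lemma IsGM.hasDeviationBound {F : Aggregator n d} (hF : IsGM F) : HasDeviationBound f F := by
  intro y S u hS
  have hsum : 0 ≤ ∑ i ∈ S, ‖y i - u‖ ^ 2 := Finset.sum_nonneg fun _ _ => sq_nonneg _
  rcases eq_or_ne (F y) u with hu | hu
  · simpa [hu] using hsum
  set D : ℝ := ‖F y - u‖ with hD
  have hD0 : 0 < D := norm_pos_iff.2 (sub_ne_zero.2 hu)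
  -- Moving the minimizer a quarter of the way towards `u` does not decrease the objective.
  set a : Vec d := (3 / 4 : ℝ) • (F y - u) with ha
  set z : Vec d := u + a with hz
  have hna : ‖a‖ = 3 / 4 * D := by rw [ha, norm_smul]; norm_num [hD]
  have ha0 : a ≠ 0 := by rw [← norm_pos_iff, hna]; positivity
  have hFz : F y = z + (1 / 3 : ℝ) • a := by rw [hz, ha]; module
  have hgood : ∀ i ∈ S, D / 4 - 8 / 9 * ‖y i - u‖ ^ 2 / D ≤ ‖F y - y i‖ - ‖z - y i‖ := by
    intro i _
    have h := norm_add_smul_sub_norm_ge (w := z - y i) ha0 (by norm_num : (0 : ℝ) ≤ 1 / 3)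
    have e1 : z - y i + (1 / 3 : ℝ) • a = F y - y i := by rw [hFz]; abel
    have e2 : a - (z - y i) = y i - u := by rw [hz]; abel
    rw [e1, e2, hna] at h
    refine le_trans (le_of_eq ?_) h
    field_simp
    ring
  have hbad : ∀ i ∈ Sᶜ, -(D / 4) ≤ ‖F y - y i‖ - ‖z - y i‖ := by
    intro i _
    have h := norm_sub_le (F y - y i) ((1 / 3 : ℝ) • a)
    have e1 : F y - y i - (1 / 3 : ℝ) • a = z - y i := by rw [hFz]; abel
    have e2 : ‖(1 / 3 : ℝ) • a‖ = D / 4 := by rw [norm_smul, hna]; norm_num; ring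
    rw [e1, e2] at h
    linarith
  have htot : ∑ i, (‖F y - y i‖ - ‖z - y i‖) ≤ 0 := by
    rw [Finset.sum_sub_distrib]
    linarith [hF y z]
  rw [← Finset.sum_add_sum_compl S] at htot
  have h1 := Finset.sum_le_sum hgood
  have h2 := Finset.sum_le_sum hbad
  have hDc : (Sᶜ).card = f := by rw [Finset.card_compl, Fintype.card_fin]; omega
  have hSc : (S.card : ℝ) = n - f := by
    have : (S.card : ℝ) + f = n := by exact_mod_cast hS
    linarith
  rw [Finset.sum_sub_distrib, Finset.sum_const, nsmul_eq_mul, hSc, ← Finset.sum_div,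
    ← Finset.mul_sum] at h1
  rw [Finset.sum_const, nsmul_eq_mul, hDc] at h2
  set Q : ℝ := ∑ i ∈ S, ‖y i - u‖ ^ 2 with hQ
  have h3 : ((n : ℝ) - 2 * f) * (D / 4) ≤ 8 / 9 * Q / D := by linarith
  rw [le_div_iff₀ hD0] at h3
  nlinarith

lemma krumScore_le {S : Finset (Fin n)} (hS : S.card + f = n) (x : Fin n → Vec d) (i : Fin n) :
    krumScore f x i ≤ ∑ j ∈ S, ‖x i - x j‖ ^ 2 := by
  have : n - f = S.card := by omega
  rw [krumScore, this]
  exact sum_orderStat_le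

/-- A Multi-Krum score accounts for the distances to at least `n - 2f` honest inputs, so an input
with a small score is close to any point `u` around which the honest inputs gather. -/
lemma mul_norm_sub_sq_le_krumScore {S : Finset (Fin n)} (hS : S.card + f = n)
    (x : Fin n → Vec d) (i : Fin n) (u : Vec d) :
    ((n : ℝ) - 2 * f) * ‖x i - u‖ ^ 2 ≤ 2 * krumScore f x i + 2 * ∑ j ∈ S, ‖x j - u‖ ^ 2 := by
  set v : Fin n → ℝ := fun j => ‖x i - x j‖ ^ 2 with hv
  set A := rankBlock v 0 (n - f) with hA
  have hscore : krumScore f x i = ∑ j ∈ A, v j := by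
    rw [krumScore, Finset.range_eq_Ico]
    exact sum_orderStat v (fun t => t) 0 (Nat.sub_le n f)
  have hcard : (n : ℝ) - 2 * f ≤ (A ∩ S).card := by
    have h1 : A.card = n - f := by rw [hA, card_rankBlock v 0 (Nat.sub_le n f)]; omega
    have h2 := card_le_card_inter_add hS A
    have h3 : n ≤ (A ∩ S).card + 2 * f := by omega
    have : (n : ℝ) ≤ (A ∩ S).card + 2 * f := by exact_mod_cast h3
    linarith
  have hpt : ∀ j ∈ A ∩ S, ‖x i - u‖ ^ 2 ≤ 2 * v j + 2 * ‖x j - u‖ ^ 2 := by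
    intro j _
    have h := norm_sub_le_norm_sub_add_norm_sub (x i) (x j) u
    have h' := pow_le_pow_left₀ (norm_nonneg _) h 2
    simp only [hv]
    nlinarith [sq_nonneg (‖x i - x j‖ - ‖x j - u‖)]
  have h1 := Finset.sum_le_sum hpt
  rw [Finset.sum_const, nsmul_eq_mul, Finset.sum_add_distrib, ← Finset.mul_sum,
    ← Finset.mul_sum] at h1
  have h2 : ∑ j ∈ A ∩ S, v j ≤ ∑ j ∈ A, v j :=
    Finset.sum_le_sum_of_subset_of_nonneg Finset.inter_subset_left fun _ _ _ => sq_nonneg _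
  have h3 : ∑ j ∈ A ∩ S, ‖x j - u‖ ^ 2 ≤ ∑ j ∈ S, ‖x j - u‖ ^ 2 :=
    Finset.sum_le_sum_of_subset_of_nonneg Finset.inter_subset_right fun _ _ _ => sq_nonneg _
  have h4 := mul_le_mul_of_nonneg_right hcard (sq_nonneg ‖x i - u‖)
  rw [hscore]
  linarith

lemma IsMultiKrum.hasDeviationBound {F : Aggregator n d} (hF : IsMultiKrum f F) (hfn : 2 * f < n) :
    HasDeviationBound f F := by
  obtain ⟨q, hq1, hq, hF⟩ := hF
  intro y S u hS
  obtain ⟨M, hM, hsel, hFM⟩ := hF y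
  set Q : ℝ := ∑ i ∈ S, ‖y i - u‖ ^ 2 with hQ
  have hM0 : (0 : ℝ) < M.card := by rw [hM]; exact_mod_cast hq1
  have hS0 : (0 : ℝ) < S.card := by
    have : 0 < S.card := by omega
    exact_mod_cast this
  have h2f : (0 : ℝ) ≤ (n : ℝ) - 2 * f := by
    have : (2 * f : ℝ) < n := by exact_mod_cast hfn
    linarith
  have hscoreS : ∑ i ∈ S, krumScore f y i ≤ 2 * S.card * Q := by
    refine (Finset.sum_le_sum fun i _ => krumScore_le hS y i).trans ?_
    rw [sum_sum_norm_sub_sq]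
    exact mul_le_mul_of_nonneg_left (sum_norm_sub_mean_sq_le S y u) (by positivity)
  have hscoreM : ∑ i ∈ M, krumScore f y i ≤ 2 * M.card * Q := by
    have h := card_mul_sum_le_card_mul_sum (S := S) (by omega) hsel
    have h' := mul_le_mul_of_nonneg_left hscoreS hM0.le
    refine le_of_mul_le_mul_left ?_ hS0
    linarith
  have hdev := Finset.sum_le_sum fun i (_ : i ∈ M) => mul_norm_sub_sq_le_krumScore hS y i u
  rw [← Finset.mul_sum, Finset.sum_add_distrib, ← Finset.mul_sum, Finset.sum_const,
    nsmul_eq_mul] at hdev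
  have hjensen := mul_le_mul_of_nonneg_left (card_mul_norm_mean_sub_sq_le M y u) h2f
  rw [hFM]
  refine le_of_mul_le_mul_left ?_ hM0
  linarith

/-! ### Nearest-neighbor mixing -/

/-- Mixing contracts the honest inputs towards their average: the inputs that `N x i` averages
in place of honest ones are at most `f`, and no further from `x i` than those they replace. -/
lemma IsNNM.norm_sub_mean_sq_le {N : (Fin n → Vec d) → Fin n → Vec d} (hN : IsNNM f N)
    (x : Fin n → Vec d) {S : Finset (Fin n)} (hS : S.card + f = n) (i : Fin n) :
    (S.card : ℝ) ^ 2 * ‖N x i - mean S x‖ ^ 2 ≤ 4 * f * ∑ j ∈ S, ‖x j - x i‖ ^ 2 := by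
  obtain ⟨A, hA, hnear, hNA⟩ := hN x i
  have hAS : A.card = S.card := by omega
  rcases S.eq_empty_or_nonempty with rfl | hSne
  · simp
  have hAne : A.Nonempty := Finset.card_pos.1 (hAS ▸ hSne.card_pos)
  have hdiff : (S.card : ℝ) • (N x i - mean S x)
      = ∑ j ∈ A \ S, (x j - x i) - ∑ j ∈ S \ A, (x j - x i) := by
    have e : (S.card : ℝ) • (N x i - mean S x)
        = ∑ j ∈ A, (x j - x i) - ∑ j ∈ S, (x j - x i) := by
      rw [smul_sub, card_smul_mean hSne, hNA, ← hAS, card_smul_mean hAne,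
        Finset.sum_sub_distrib, Finset.sum_sub_distrib, Finset.sum_const, Finset.sum_const, hAS]
      abel
    rw [e, ← Finset.sum_inter_add_sum_sdiff A S, ← Finset.sum_inter_add_sum_sdiff S A,
      Finset.inter_comm]
    abel
  have hsel : ∑ j ∈ A \ S, ‖x j - x i‖ ≤ ∑ j ∈ S \ A, ‖x j - x i‖ := by
    have h := sum_le_sum_of_forall_le hAS hnear
    rw [← Finset.sum_inter_add_sum_sdiff A S, ← Finset.sum_inter_add_sum_sdiff S A,
      Finset.inter_comm] at h
    linarith
  have hnorm : (S.card : ℝ) * ‖N x i - mean S x‖ ≤ 2 * ∑ j ∈ S \ A, ‖x j - x i‖ := by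
    have h : ‖(S.card : ℝ) • (N x i - mean S x)‖
        ≤ ∑ j ∈ A \ S, ‖x j - x i‖ + ∑ j ∈ S \ A, ‖x j - x i‖ := by
      rw [hdiff]
      exact (norm_sub_le _ _).trans (add_le_add (norm_sum_le _ _) (norm_sum_le _ _))
    rw [norm_smul, Real.norm_of_nonneg (by positivity)] at h
    linarith
  have hcard : ((S \ A).card : ℝ) ≤ f := by
    have h1 := Finset.card_inter_add_card_sdiff S A
    have h2 := card_le_card_inter_add hS A
    rw [Finset.inter_comm] at h2
    have : (S \ A).card ≤ f := by omega
    exact_mod_cast this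
  have hsq := pow_le_pow_left₀ (by positivity) hnorm 2
  have hcs := sq_sum_le_card_mul_sum_sq (s := S \ A) (f := fun j => ‖x j - x i‖)
  have hsub : ∑ j ∈ S \ A, ‖x j - x i‖ ^ 2 ≤ ∑ j ∈ S, ‖x j - x i‖ ^ 2 :=
    Finset.sum_le_sum_of_subset_of_nonneg Finset.sdiff_subset fun _ _ _ => sq_nonneg _
  have h0 : 0 ≤ ∑ j ∈ S \ A, ‖x j - x i‖ ^ 2 := Finset.sum_nonneg fun _ _ => sq_nonneg _
  have hmul := mul_le_mul hcard hsub h0 (Nat.cast_nonneg f)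
  rw [mul_pow, mul_pow] at hsq
  linarith

lemma IsNNM.sum_norm_sub_mean_sq_le {N : (Fin n → Vec d) → Fin n → Vec d} (hN : IsNNM f N)
    (x : Fin n → Vec d) {S : Finset (Fin n)} (hS : S.card + f = n) (hS0 : 0 < S.card) :
    (S.card : ℝ) * ∑ i ∈ S, ‖N x i - mean S x‖ ^ 2 ≤ 8 * f * ∑ i ∈ S, ‖x i - mean S x‖ ^ 2 := by
  have h := Finset.sum_le_sum fun i (_ : i ∈ S) => hN.norm_sub_mean_sq_le x hS i
  rw [← Finset.mul_sum, ← Finset.mul_sum, Finset.sum_comm, sum_sum_norm_sub_sq] at h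
  have h0 : (0 : ℝ) < S.card := by exact_mod_cast hS0
  refine le_of_mul_le_mul_left ?_ h0
  linarith

/-- All rules composed with nearest-neighbor mixing are `(f, 48 f / (n - 2f))`-robust. -/
lemma IsRuleWithNNM.isRobust {F : Aggregator n d} (hF : IsRuleWithNNM f F) (hfn : 2 * f < n) :
    IsRobust f (48 * f / ((n : ℝ) - 2 * f)) F := by
  obtain ⟨F₀, N, hF₀, hN, rfl⟩ := hF
  have hdev : HasDeviationBound f F₀ := by
    rcases hF₀ with h | h | h | h
    · exact h.hasDeviationBound hfn
    · exact h.hasDeviationBound hfn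
    · exact h.hasDeviationBound
    · exact h.hasDeviationBound hfn
  intro x S hS
  have hS0 : 0 < S.card := by omega
  have hS0' : (0 : ℝ) < S.card := by exact_mod_cast hS0
  have hN0 : (0 : ℝ) < (n : ℝ) - 2 * f := by
    have : (2 * f : ℝ) < n := by exact_mod_cast hfn
    linarith
  have h1 := hdev (N x) S (mean S x) hS
  have h2 := hN.sum_norm_sub_mean_sq_le x hS hS0
  rw [div_div, div_mul_eq_mul_div, le_div_iff₀ (by positivity), Function.comp_apply]
  have h3 := mul_le_mul_of_nonneg_left h1 hS0'.le
  linarith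

/-! ### Robustness coefficients -/

lemma isClosed_setOf_isRobust (f : ℕ) (F : Aggregator n d) : IsClosed {κ : ℝ | IsRobust f κ F} := by
  simp only [IsRobust, Set.ofPred_forall]
  refine isClosed_iInter fun x => isClosed_iInter fun S => isClosed_iInter fun _ => ?_
  exact isClosed_le continuous_const (by fun_prop)

/-- If the robustness coefficients are bounded below, the smallest one is admissible; otherwise
some of them lie below the reference value. -/
lemma IsRobust.exists_isRobustnessCoefficient {F : Aggregator n d} {κ : ℝ} (h : IsRobust f κ F) :
    ∃ κ : ℝ, IsRobustnessCoefficient f κ F := by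
  by_cases hb : BddBelow {κ : ℝ | IsRobust f κ F}
  · exact ⟨_, (isClosed_setOf_isRobust f F).csInf_mem ⟨κ, h⟩ hb,
      fun κ' h' => le_max_of_le_left (csInf_le hb h')⟩
  · obtain ⟨κ', h', hlt⟩ := not_bddBelow_iff.1 hb (coefficientBound n f)
    exact ⟨κ', h', fun _ _ => le_max_of_le_right hlt.le⟩

/-- No rule has a robustness coefficient below `f / (n - 2f)`: if `f` inputs equal `e` and the
others vanish, the output has to be `0`, because these other inputs could be the honest ones; but the
`f` inputs equal to `e` may all be honest as well. -/
lemma IsRobust.le_coefficient {F : Aggregator n d} {κ : ℝ} (h : IsRobust f κ F) (hf : 0 < f)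
    (hfn : 2 * f < n) {e : Vec d} (he : ‖e‖ = 1) : (f : ℝ) / ((n : ℝ) - 2 * f) ≤ κ := by
  obtain ⟨D, -, hD⟩ := Finset.exists_subset_card_eq
    (show f ≤ (Finset.univ : Finset (Fin n)).card by simp; omega)
  obtain ⟨S, hDS, -, hS⟩ := Finset.exists_subsuperset_card_eq (Finset.subset_univ D)
    (show D.card ≤ n - f by omega) (by simp)
  set x : Fin n → Vec d := fun i => if i ∈ D then e else 0 with hx
  have hDcard : (Dᶜ).card + f = n := by rw [Finset.card_compl, Fintype.card_fin]; omega
  have hzero : ∀ i ∈ Dᶜ, x i = 0 := fun i hi => by simp_all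
  have hmeanD : mean Dᶜ x = 0 := by rw [mean, Finset.sum_eq_zero hzero, smul_zero]
  have hFx : F x = 0 := by
    have h1 := h x Dᶜ hDcard
    rw [hmeanD, sub_zero, Finset.sum_eq_zero fun i hi => by simp [hzero i hi], mul_zero] at h1
    simpa using h1
  have hS0 : (0 : ℝ) < S.card := by
    have : 0 < S.card := by omega
    exact_mod_cast this
  have hSc : (S.card : ℝ) = n - f := by
    rw [hS, Nat.cast_sub (by omega)]
  have hsum : ∑ i ∈ S, x i = (f : ℝ) • e := by
    rw [hx, Finset.sum_ite_mem, Finset.inter_eq_right.2 hDS, Finset.sum_const, hD,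
      Nat.cast_smul_eq_nsmul]
  have hsq : ∑ i ∈ S, ‖x i‖ ^ 2 = f := by
    have : ∀ i, ‖x i‖ ^ 2 = if i ∈ D then (1 : ℝ) else 0 := fun i => by
      simp only [hx]; split_ifs <;> simp [he]
    simp only [this]
    rw [Finset.sum_ite_mem, Finset.inter_eq_right.2 hDS]
    simp [hD]
  have hmean : ‖mean S x‖ ^ 2 = (f / S.card : ℝ) ^ 2 := by
    rw [mean, hsum, smul_smul, norm_smul, he, mul_one, Real.norm_of_nonneg (by positivity)]
    congr 1
    field_simp
  have h2 := h x S (by omega)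
  rw [hFx, zero_sub, norm_neg, sum_norm_sub_mean_sq, hsq, hmean] at h2
  have hf0 : (0 : ℝ) < f := by exact_mod_cast hf
  have hN0 : (0 : ℝ) < (n : ℝ) - 2 * f := by
    have : (2 * f : ℝ) < n := by exact_mod_cast hfn
    linarith
  have h3 : (f : ℝ) / S.card * (f / S.card) ≤ κ * ((n : ℝ) - 2 * f) / S.card * (f / S.card) := by
    calc (f : ℝ) / S.card * (f / S.card) = (f / S.card : ℝ) ^ 2 := by ring
      _ ≤ _ := h2
      _ = κ * (S.card - f) / S.card * (f / S.card) := by field_simp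
      _ = _ := by rw [hSc]; ring
  have h4 := le_of_mul_le_mul_right h3 (by positivity)
  rw [div_le_div_iff_of_pos_right hS0] at h4
  rwa [div_le_iff₀ hN0]

/-- A robust rule does not amplify norms by more than `√(1 + κ)`, since the squared norm of the honest
average and the honest variance add up to the honest second moment. -/
lemma IsRobust.norm_le {F : Aggregator n d} {κ : ℝ} (h : IsRobust f κ F) (hκ : 0 ≤ κ)
    {x : Fin n → Vec d} {S : Finset (Fin n)} (hS : S.card + f = n) (hS0 : 0 < S.card) {c : ℝ}
    (hc : 0 ≤ c) (hx : ∀ i ∈ S, ‖x i‖ ≤ c) : ‖F x‖ ≤ √(1 + κ) * c := by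
  have h0 : (0 : ℝ) < S.card := by exact_mod_cast hS0
  have h1 := h x S hS
  set V : ℝ := 1 / (S.card : ℝ) * ∑ i ∈ S, ‖x i - mean S x‖ ^ 2 with hV
  have hV0 : 0 ≤ V := by positivity
  have h2 : ‖F x - mean S x‖ ^ 2 ≤ κ * V := by rw [hV]; convert h1 using 1; ring
  have h3 : ‖mean S x‖ ^ 2 + V ≤ c ^ 2 := by
    have hs : ∑ i ∈ S, ‖x i‖ ^ 2 ≤ S.card * c ^ 2 := by
      rw [← nsmul_eq_mul, ← Finset.sum_const]
      exact Finset.sum_le_sum fun i hi => pow_le_pow_left₀ (norm_nonneg _) (hx i hi) 2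
    rw [hV, sum_norm_sub_mean_sq, one_div, mul_sub, inv_mul_cancel_left₀ h0.ne']
    have := mul_le_mul_of_nonneg_left hs (inv_nonneg.2 h0.le)
    rw [inv_mul_cancel_left₀ h0.ne'] at this
    linarith
  have h4 : ‖F x‖ ≤ ‖F x - mean S x‖ + ‖mean S x‖ := by
    simpa using norm_add_le (F x - mean S x) (mean S x)
  refine le_of_abs_le (abs_le_of_sq_le_sq ?_ (by positivity))
  rw [mul_pow, Real.sq_sqrt (by linarith)]
  have h5 := pow_le_pow_left₀ (norm_nonneg _) h4 2
  set p := ‖F x - mean S x‖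
  set q := ‖mean S x‖
  -- Cauchy–Schwarz: `(√κ √V + q)² ≤ (κ + 1) (V + q²)`.
  have h6 : (p + q) ^ 2 ≤ (1 + κ) * (V + q ^ 2) := by
    have h7 : (p * q) ^ 2 ≤ (κ * q ^ 2) * V := by
      rw [mul_pow]; nlinarith [mul_le_mul_of_nonneg_right h2 (sq_nonneg q)]
    have h8 : 2 * (p * q) ≤ κ * q ^ 2 + V := by
      refine le_of_abs_le (abs_le_of_sq_le_sq ?_ (by positivity))
      nlinarith [sq_nonneg (κ * q ^ 2 - V)]
    nlinarith
  nlinarith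

/-! ### Adaptive clipping -/

lemma norm_clip_le {C : ℝ} (hC : 0 ≤ C) (x : Vec d) : ‖clip C x‖ ≤ C := by
  rw [clip, norm_smul, Real.norm_of_nonneg (le_min zero_le_one (by positivity))]
  rcases eq_or_ne ‖x‖ 0 with hx | hx
  · simpa [hx] using hC
  · calc min 1 (C / ‖x‖) * ‖x‖ ≤ C / ‖x‖ * ‖x‖ := by gcongr; exact min_le_right _ _
      _ = C := div_mul_cancel₀ C hx

lemma clip_of_norm_le {C : ℝ} {x : Vec d} (hx : ‖x‖ ≤ C) : clip C x = x := by
  rcases eq_or_ne x 0 with rfl | h0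
  · simp [clip]
  · rw [clip, min_eq_left, one_smul]
    rwa [one_le_div (norm_pos_iff.2 h0)]

/-- Clipping at `C` is the projection onto the ball of radius `C`. -/
lemma inner_sub_clip_nonneg {C : ℝ} (x : Vec d) {z : Vec d} (hz : ‖z‖ ≤ C) :
    0 ≤ inner ℝ (x - clip C x) (clip C x - z) := by
  rcases le_total ‖x‖ C with h | h
  · simp [clip_of_norm_le h]
  rcases eq_or_ne x 0 with rfl | h0
  · simp [clip]
  have hx : 0 < ‖x‖ := norm_pos_iff.2 h0
  have hc : clip C x = (C / ‖x‖) • x := by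
    rw [clip, min_eq_right]
    rwa [div_le_one hx]
  have e : x - (C / ‖x‖) • x = (1 - C / ‖x‖) • x := by rw [sub_smul, one_smul]
  rw [hc, e, real_inner_smul_left, inner_sub_right, real_inner_smul_right,
    real_inner_self_eq_norm_sq]
  have h1 : 0 ≤ 1 - C / ‖x‖ := by
    have : C / ‖x‖ ≤ 1 := by rwa [div_le_one hx]
    linarith
  have h2 : C / ‖x‖ * ‖x‖ ^ 2 = C * ‖x‖ := by field_simp
  have h3 : inner ℝ x z ≤ ‖x‖ * C :=
    (real_inner_le_norm x z).trans (mul_le_mul_of_nonneg_left hz hx.le)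
  refine mul_nonneg h1 ?_
  linarith

/-- Clipping is firmly nonexpansive. -/
lemma norm_clip_sub_clip_sq_add_le {C : ℝ} (hC : 0 ≤ C) (x y : Vec d) :
    ‖clip C x - clip C y‖ ^ 2 + ‖(x - clip C x) - (y - clip C y)‖ ^ 2 ≤ ‖x - y‖ ^ 2 := by
  have h1 := inner_sub_clip_nonneg x (norm_clip_le hC y)
  have h2 := inner_sub_clip_nonneg y (norm_clip_le hC x)
  have e : x - y = (clip C x - clip C y) + ((x - clip C x) - (y - clip C y)) := by abel
  rw [e, norm_add_sq_real]
  have : inner ℝ (clip C x - clip C y) ((x - clip C x) - (y - clip C y))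
      = inner ℝ (x - clip C x) (clip C x - clip C y)
        + inner ℝ (y - clip C y) (clip C y - clip C x) := by
    rw [inner_sub_right, real_inner_comm, real_inner_comm (y - clip C y),
      ← neg_sub (clip C x) (clip C y), inner_neg_right]
    ring
  linarith

/-- The parameter `k = ⌊2 (f / n) (n - f)⌋` of `arc`: at most `k` vectors are shortened. -/
def clipCount (n f : ℕ) : ℕ := ⌊2 * ((f : ℝ) / n) * ((n : ℝ) - f)⌋₊

/-- The clipping threshold of `arc`. -/
def clipThreshold (f : ℕ) (x : Fin n → Vec d) : ℝ :=
  orderStat (fun i => ‖x i‖) (n - 1 - clipCount n f)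

lemma arc_apply (f : ℕ) (x : Fin n → Vec d) (i : Fin n) :
    arc f x i = clip (clipThreshold f x) (x i) := rfl

lemma mul_clipCount_le (hfn : 2 * f < n) : (n : ℝ) * clipCount n f ≤ 2 * f * ((n : ℝ) - f) := by
  have hn : (0 : ℝ) < n := by
    have : 0 < n := by omega
    exact_mod_cast this
  have hfn' : (2 * f : ℝ) < n := by exact_mod_cast hfn
  have hf0 : (0 : ℝ) ≤ f := Nat.cast_nonneg f
  have h := Nat.floor_le (show 0 ≤ 2 * ((f : ℝ) / n) * ((n : ℝ) - f) from
    mul_nonneg (by positivity) (by linarith))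
  calc (n : ℝ) * clipCount n f ≤ n * (2 * ((f : ℝ) / n) * ((n : ℝ) - f)) :=
        mul_le_mul_of_nonneg_left h hn.le
    _ = _ := by field_simp

lemma le_clipCount (hfn : 2 * f < n) : f ≤ clipCount n f := by
  have hn : (0 : ℝ) < n := by
    have : 0 < n := by omega
    exact_mod_cast this
  have hfn' : (2 * f : ℝ) < n := by exact_mod_cast hfn
  have hf0 : (0 : ℝ) ≤ f := Nat.cast_nonneg f
  refine Nat.le_floor ?_
  rw [mul_div_assoc', div_mul_eq_mul_div, le_div_iff₀ hn]
  nlinarith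

lemma clipCount_lt (hfn : 2 * f < n) : clipCount n f < n := by
  have h := mul_clipCount_le hfn
  have hfn' : (2 * f : ℝ) < n := by exact_mod_cast hfn
  have hf0 : (0 : ℝ) ≤ f := Nat.cast_nonneg f
  have hn : (0 : ℝ) < n := by linarith
  have : (clipCount n f : ℝ) < n := by
    refine lt_of_mul_lt_mul_left ?_ hn.le
    nlinarith
  exact_mod_cast this

lemma clipThreshold_nonneg (f : ℕ) (x : Fin n → Vec d) : 0 ≤ clipThreshold f x := by
  rw [clipThreshold, orderStat]
  split_ifs
  · exact norm_nonneg _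
  · exact le_rfl

/-- Since `k ≥ f`, the threshold is at most the norm of some honest input. -/
lemma clipThreshold_le (hfn : 2 * f < n) {x : Fin n → Vec d} {S : Finset (Fin n)}
    (hS : S.card + f = n) {c : ℝ} (hx : ∀ i ∈ S, ‖x i‖ ≤ c) : clipThreshold f x ≤ c := by
  set v : Fin n → ℝ := fun i => ‖x i‖ with hv
  have h1 := le_clipCount hfn
  have h2 := clipCount_lt hfn
  have h3 := card_le_card_inter_add hS (rankBlock v (n - 1 - clipCount n f) n)
  rw [card_rankBlock v _ le_rfl] at h3
  obtain ⟨i, hi⟩ := Finset.card_pos.1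
    (show 0 < (rankBlock v (n - 1 - clipCount n f) n ∩ S).card by omega)
  rw [Finset.mem_inter, mem_rankBlock] at hi
  refine le_trans ?_ (hx i hi.2)
  have h := orderStat_mono (v := v) hi.1.1 hi.1.2
  rwa [orderStat_rank] at h

lemma norm_arc_le (hfn : 2 * f < n) {x : Fin n → Vec d} {S : Finset (Fin n)}
    (hS : S.card + f = n) {c : ℝ} (hx : ∀ i ∈ S, ‖x i‖ ≤ c) (i : Fin n) : ‖arc f x i‖ ≤ c :=
  (norm_clip_le (clipThreshold_nonneg f x) (x i)).trans (clipThreshold_le hfn hS hx)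

lemma card_filter_sub_arc_ne_zero_le (hfn : 2 * f < n) (x : Fin n → Vec d) (S : Finset (Fin n)) :
    (S.filter fun i => x i - arc f x i ≠ 0).card ≤ clipCount n f := by
  set v : Fin n → ℝ := fun i => ‖x i‖ with hv
  have h2 := clipCount_lt hfn
  have hsub : (S.filter fun i => x i - arc f x i ≠ 0) ⊆ rankBlock v (n - clipCount n f) n := by
    intro i hi
    refine mem_rankBlock.2 ⟨?_, rank_lt v i⟩
    by_contra hcon
    refine (Finset.mem_filter.1 hi).2 ?_
    have h := orderStat_mono (v := v) (show rank v i ≤ n - 1 - clipCount n f by omega) (by omega)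
    rw [orderStat_rank] at h
    rw [arc_apply, clip_of_norm_le (show ‖x i‖ ≤ clipThreshold f x from h), sub_self]
  have h := Finset.card_le_card hsub
  rw [card_rankBlock v _ le_rfl] at h
  omega

/-- The bias of clipping: few of the displacements `x i - arc f x i` are nonzero, so that their
squared average is small compared to their variance. -/
lemma norm_mean_sub_mean_arc_sq_le (hfn : 2 * f < n) (x : Fin n → Vec d) {S : Finset (Fin n)}
    (hS : S.card + f = n) :
    ((n : ℝ) - 2 * f) * (S.card * ‖mean S x - mean S (arc f x)‖ ^ 2)
      ≤ 2 * f * ∑ i ∈ S, ‖(x i - arc f x i) - mean S (fun i => x i - arc f x i)‖ ^ 2 := by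
  set δ : Fin n → Vec d := fun i => x i - arc f x i with hδ
  have hS0 : (0 : ℝ) < S.card := by
    have : 0 < S.card := by omega
    exact_mod_cast this
  have hSne : S.Nonempty := Finset.card_pos.1 (by exact_mod_cast hS0)
  have hSc : (S.card : ℝ) = n - f := by
    have : (S.card : ℝ) + f = n := by exact_mod_cast hS
    linarith
  rw [← mean_sub, sum_norm_sub_mean_sq]
  have h1 : (S.card : ℝ) * ‖mean S δ‖ ≤ ∑ i ∈ S.filter (fun i => δ i ≠ 0), ‖δ i‖ := by
    have : (S.card : ℝ) * ‖mean S δ‖ = ‖∑ i ∈ S, δ i‖ := by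
      rw [← card_smul_mean hSne, norm_smul, Real.norm_of_nonneg hS0.le]
    rw [this, ← Finset.sum_filter_ne_zero]
    exact norm_sum_le _ _
  have h2 := pow_le_pow_left₀ (by positivity) h1 2
  have h3 := sq_sum_le_card_mul_sum_sq (s := S.filter fun i => δ i ≠ 0) (f := fun i => ‖δ i‖)
  have h4 : ∑ i ∈ S.filter (fun i => δ i ≠ 0), ‖δ i‖ ^ 2 ≤ ∑ i ∈ S, ‖δ i‖ ^ 2 :=
    Finset.sum_le_sum_of_subset_of_nonneg (Finset.filter_subset _ _) fun _ _ _ => sq_nonneg _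
  have h5 : ((S.filter fun i => δ i ≠ 0).card : ℝ) ≤ clipCount n f := by
    exact_mod_cast card_filter_sub_arc_ne_zero_le hfn x S
  have h6 : ((S.card : ℝ) * ‖mean S δ‖) ^ 2 ≤ clipCount n f * ∑ i ∈ S, ‖δ i‖ ^ 2 :=
    h2.trans (h3.trans (mul_le_mul h5 h4 (by positivity) (by positivity)))
  have h7 := mul_clipCount_le hfn
  have hQ : 0 ≤ ∑ i ∈ S, ‖δ i‖ ^ 2 := by positivity
  have h8 : S.card * ((n : ℝ) * (S.card * ‖mean S δ‖ ^ 2))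
      ≤ S.card * (2 * f * ∑ i ∈ S, ‖δ i‖ ^ 2) := by
    have a1 := mul_le_mul_of_nonneg_left h6 (Nat.cast_nonneg (α := ℝ) n)
    have a2 := mul_le_mul_of_nonneg_right h7 hQ
    rw [← hSc] at a2
    nlinarith
  have h9 := le_of_mul_le_mul_left h8 hS0
  linarith

/-- Clipping splits the variance: part of it is kept, the rest pays for the bias of clipping. -/
lemma sum_arc_add_sum_sub_arc_le (x : Fin n → Vec d) {S : Finset (Fin n)} (hS0 : 0 < S.card) :
    ∑ i ∈ S, ‖arc f x i - mean S (arc f x)‖ ^ 2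
        + ∑ i ∈ S, ‖(x i - arc f x i) - mean S (fun i => x i - arc f x i)‖ ^ 2
      ≤ ∑ i ∈ S, ‖x i - mean S x‖ ^ 2 := by
  have h0 : (0 : ℝ) < 2 * S.card := by
    have : (0 : ℝ) < S.card := by exact_mod_cast hS0
    linarith
  refine le_of_mul_le_mul_left ?_ h0
  rw [mul_add, ← sum_sum_norm_sub_sq, ← sum_sum_norm_sub_sq S x,
    ← sum_sum_norm_sub_sq S (fun i => x i - arc f x i), ← Finset.sum_add_distrib]
  refine Finset.sum_le_sum fun i _ => ?_
  rw [← Finset.sum_add_distrib]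
  exact Finset.sum_le_sum fun j _ =>
    norm_clip_sub_clip_sq_add_le (clipThreshold_nonneg f x) (x i) (x j)

/-- Adaptive clipping preserves robustness, at the price of adding `2f / (n - 2f)` to the
coefficient. -/
lemma IsRobust.comp_arc {F : Aggregator n d} {κ : ℝ} (h : IsRobust f κ F) (hκ : 0 ≤ κ)
    (hfn : 2 * f < n) : IsRobust f (κ + 2 * f / ((n : ℝ) - 2 * f)) (F ∘ arc f) := by
  intro x S hS
  have hS0 : 0 < S.card := by omega
  have hSc : (0 : ℝ) < S.card := by exact_mod_cast hS0
  have hN0 : (0 : ℝ) < (n : ℝ) - 2 * f := by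
    have : (2 * f : ℝ) < n := by exact_mod_cast hfn
    linarith
  have h1 := h (arc f x) S hS
  have h2 := norm_mean_sub_mean_arc_sq_le hfn x hS
  have h3 := sum_arc_add_sum_sub_arc_le (f := f) x hS0
  set V₁ := ∑ i ∈ S, ‖arc f x i - mean S (arc f x)‖ ^ 2
  set V₂ := ∑ i ∈ S, ‖(x i - arc f x i) - mean S (fun i => x i - arc f x i)‖ ^ 2
  set V := ∑ i ∈ S, ‖x i - mean S x‖ ^ 2
  have hV₁ : 0 ≤ V₁ := Finset.sum_nonneg fun _ _ => sq_nonneg _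
  have hV₂ : 0 ≤ V₂ := Finset.sum_nonneg fun _ _ => sq_nonneg _
  set p := ‖F (arc f x) - mean S (arc f x)‖
  set q := ‖mean S x - mean S (arc f x)‖
  set r : ℝ := 2 * f / ((n : ℝ) - 2 * f) with hr
  have hr0 : 0 ≤ r := div_nonneg (by positivity) hN0.le
  have hp : S.card * p ^ 2 ≤ κ * V₁ := by
    rw [div_mul_eq_mul_div, le_div_iff₀ hSc] at h1
    linarith
  have hq : S.card * q ^ 2 ≤ r * V₂ := by
    rw [hr, div_mul_eq_mul_div, le_div_iff₀ hN0]
    linarith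
  have htri : ‖(F ∘ arc f) x - mean S x‖ ≤ p + q := by
    have := norm_sub_le_norm_sub_add_norm_sub (F (arc f x)) (mean S (arc f x)) (mean S x)
    rwa [norm_sub_rev (mean S (arc f x)) (mean S x)] at this
  have hsq := pow_le_pow_left₀ (norm_nonneg _) htri 2
  rw [div_mul_eq_mul_div, le_div_iff₀ hSc]
  -- Cauchy–Schwarz: `(√(κ V₁) + √(r V₂))² ≤ (κ + r) (V₁ + V₂)`.
  have hcross : 2 * (S.card * (p * q)) ≤ κ * V₂ + r * V₁ := by
    refine le_of_abs_le (abs_le_of_sq_le_sq ?_ (by positivity))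
    have := mul_le_mul hp hq (by positivity) (by positivity)
    nlinarith [sq_nonneg (κ * V₂ - r * V₁)]
  have hmono := mul_le_mul_of_nonneg_left h3 (add_nonneg hκ hr0)
  nlinarith

/-! ### Smooth losses -/

lemma differentiable_localLoss {m : ℕ} {Z : Type*} {ℓ : Vec d → Z → ℝ}
    (hℓ : ∀ z, Differentiable ℝ fun θ => ℓ θ z) (z : Fin m → Z) :
    Differentiable ℝ (localLoss ℓ z) := by
  unfold localLoss
  exact (Differentiable.fun_sum fun k _ => hℓ (z k)).const_mul _

lemma hasGradientAt_honestLoss {L : Fin n → Vec d → ℝ} (hL : ∀ i, Differentiable ℝ (L i))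
    (H : Finset (Fin n)) (θ : Vec d) :
    HasGradientAt (honestLoss L H) (mean H fun i => gradient (L i) θ) θ := by
  rw [hasGradientAt_iff_hasFDerivAt]
  have h := (HasFDerivAt.fun_sum (u := H) fun i _ =>
    ((hL i) θ).hasGradientAt.hasFDerivAt).const_mul (1 / (H.card : ℝ))
  rw [mean, map_smul, map_sum]
  exact h

lemma lipschitzSmooth_honestLoss {L : Fin n → Vec d → ℝ} (hL : ∀ i, Differentiable ℝ (L i))
    {c : ℝ} (hc : 0 ≤ c) (hs : ∀ i, LipschitzSmooth c (L i)) (H : Finset (Fin n)) :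
    LipschitzSmooth c (honestLoss L H) := by
  intro θ θ'
  rw [(hasGradientAt_honestLoss hL H θ).gradient, (hasGradientAt_honestLoss hL H θ').gradient,
    ← mean_sub]
  exact norm_mean_le (by positivity) fun i _ => hs i θ θ'

/-- The quadratic upper bound on a smooth function. -/
lemma LipschitzSmooth.le_quadratic {h : Vec d → ℝ} (hd : Differentiable ℝ h) {L : ℝ}
    (hs : LipschitzSmooth L h) (x v : Vec d) :
    h (x + v) ≤ h x + inner ℝ (gradient h x) v + L / 2 * ‖v‖ ^ 2 := by
  set ψ : ℝ → ℝ := fun t => h (x + t • v) - t * inner ℝ (gradient h x) v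
    - L / 2 * t ^ 2 * ‖v‖ ^ 2 with hψ
  have hder : ∀ t : ℝ, HasDerivAt ψ
      (inner ℝ (gradient h (x + t • v)) v - inner ℝ (gradient h x) v - L * t * ‖v‖ ^ 2) t := by
    intro t
    have h1 : HasDerivAt (fun t : ℝ => x + t • v) v t := by
      simpa using ((hasDerivAt_id t).smul_const v).const_add x
    have h2 := (hd (x + t • v)).hasGradientAt.hasFDerivAt.comp_hasDerivAt t h1
    have h3 := (hasDerivAt_id t).mul_const (inner ℝ (gradient h x) v)
    have h4 : HasDerivAt (fun t : ℝ => L / 2 * t ^ 2 * ‖v‖ ^ 2) (L * t * ‖v‖ ^ 2) t :=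
      (((hasDerivAt_pow 2 t).const_mul (L / 2)).mul_const (‖v‖ ^ 2)).congr_deriv (by
        push_cast; ring)
    refine ((h2.sub h3).sub h4).congr_deriv ?_
    rw [InnerProductSpace.toDual_apply_apply, one_mul]
  have hanti : AntitoneOn ψ (Set.Icc 0 1) := by
    refine antitoneOn_of_deriv_nonpos (convex_Icc 0 1)
      (fun t _ => (hder t).continuousAt.continuousWithinAt)
      (fun t _ => (hder t).differentiableAt.differentiableWithinAt) fun t ht => ?_
    rw [interior_Icc] at ht
    rw [(hder t).deriv, ← inner_sub_left]
    have h1 := real_inner_le_norm (gradient h (x + t • v) - gradient h x) v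
    have h2 := hs (x + t • v) x
    rw [add_sub_cancel_left, norm_smul, Real.norm_of_nonneg ht.1.le] at h2
    have h3 := mul_le_mul_of_nonneg_right h2 (norm_nonneg v)
    nlinarith
  have h01 := hanti (Set.left_mem_Icc.2 zero_le_one) (Set.right_mem_Icc.2 zero_le_one) zero_le_one
  simp only [hψ, one_smul, zero_smul, add_zero] at h01
  linarith

lemma LipschitzSmooth.norm_gradient_sq_le {h : Vec d → ℝ} (hd : Differentiable ℝ h) {L : ℝ}
    (hL : 0 < L) (hs : LipschitzSmooth L h) {hmin : ℝ} (hlow : ∀ y, hmin ≤ h y) (x : Vec d) :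
    ‖gradient h x‖ ^ 2 ≤ 2 * L * (h x - hmin) := by
  have h1 := hs.le_quadratic hd x (-(1 / L) • gradient h x)
  rw [real_inner_smul_right, real_inner_self_eq_norm_sq, norm_smul, mul_pow, norm_neg,
    Real.norm_of_nonneg (by positivity)] at h1
  have h2 := hlow (x + -(1 / L) • gradient h x)
  have h3 : -(1 / L) * ‖gradient h x‖ ^ 2 + L / 2 * ((1 / L) ^ 2 * ‖gradient h x‖ ^ 2)
      = -(‖gradient h x‖ ^ 2 / (2 * L)) := by
    field_simp
    ring
  have h4 : ‖gradient h x‖ ^ 2 / (2 * L) ≤ h x - hmin := by linarith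
  rw [div_le_iff₀ (by positivity)] at h4
  linarith

/-- A descent step along an inexact gradient `R`. -/
lemma LipschitzSmooth.step_le {h : Vec d → ℝ} (hd : Differentiable ℝ h) {L : ℝ}
    (hs : LipschitzSmooth L h) {γ : ℝ} (hγ : 0 ≤ γ) (hγL : γ * L ≤ 1) (x R : Vec d) :
    h (x - γ • R) + γ / 2 * ‖gradient h x‖ ^ 2
      ≤ h x + γ / 2 * ‖R - gradient h x‖ ^ 2 := by
  have h1 := hs.le_quadratic hd x (-(γ • R))
  rw [← sub_eq_add_neg, inner_neg_right, real_inner_smul_right, norm_neg, norm_smul, mul_pow,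
    Real.norm_of_nonneg hγ] at h1
  rw [norm_sub_sq_real, real_inner_comm]
  have h2 : L / 2 * (γ ^ 2 * ‖R‖ ^ 2) ≤ γ / 2 * ‖R‖ ^ 2 := by
    have := mul_le_mul_of_nonneg_left hγL (show 0 ≤ γ / 2 * ‖R‖ ^ 2 by positivity)
    linarith
  linarith

/-- Inexact gradient descent with errors at most `E` (squared). -/
lemma LipschitzSmooth.sum_norm_gradient_sq_le {h : Vec d → ℝ} (hd : Differentiable ℝ h) {L : ℝ}
    (hs : LipschitzSmooth L h) {γ : ℝ} (hγ : 0 ≤ γ) (hγL : γ * L ≤ 1) {E : ℝ} {T : ℕ}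
    {θ R : ℕ → Vec d} (hθ : ∀ t ∈ Finset.Icc 1 T, θ (t + 1) = θ t - γ • R t)
    (hE : ∀ t ∈ Finset.Icc 1 T, ‖R t - gradient h (θ t)‖ ^ 2 ≤ E) :
    h (θ (T + 1)) + γ / 2 * ∑ t ∈ Finset.Icc 1 T, ‖gradient h (θ t)‖ ^ 2
      ≤ h (θ 1) + γ / 2 * (T * E) := by
  induction T with
  | zero => simp
  | succ T ih =>
    have hsub : ∀ t ∈ Finset.Icc 1 T, t ∈ Finset.Icc 1 (T + 1) := fun t ht => by
      rw [Finset.mem_Icc] at ht ⊢; omega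
    have ih' := ih (fun t ht => hθ t (hsub t ht)) fun t ht => hE t (hsub t ht)
    have hmem : T + 1 ∈ Finset.Icc 1 (T + 1) := by simp
    have h1 := hs.step_le hd hγ hγL (θ (T + 1)) (R (T + 1))
    rw [← hθ _ hmem] at h1
    have h2 := mul_le_mul_of_nonneg_left (hE _ hmem) (by positivity : 0 ≤ γ / 2)
    rw [Finset.sum_Icc_succ_top (by omega)]
    push_cast
    linarith

/-! ### Robust-DGD -/

lemma expectOutput_eq {T : ℕ} (θ : ℕ → Vec d) (φ : Vec d → ℝ) :
    expectOutput T θ φ = 1 / (T : ℝ) * ∑ t ∈ Finset.Icc 1 T, φ (θ t) := by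
  have hset : (Set.Icc 1 T : Set ℕ) = ↑(Finset.Icc 1 T) := by simp
  rw [expectOutput, ProbabilityTheory.uniformOn, ProbabilityTheory.cond,
    MeasureTheory.integral_smul_measure, hset, MeasureTheory.Measure.count_apply_finset,
    MeasureTheory.setIntegral_finset]
  · simp
  · rw [← Set.biUnion_of_singleton (↑(Finset.Icc 1 T) : Set ℕ),
      MeasureTheory.integrableOn_finite_biUnion (Finset.finite_toSet _)]
    exact fun i _ => MeasureTheory.integrableOn_singleton (by simp) (by simp)

/-- Growth of the honest gradients along an execution: one step changes them by at most
`γ L √(1 + κ)` times the largest honest gradient norm. -/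
lemma IsExecution.norm_gradient_le {Loss : Fin n → Vec d → ℝ} {H : Finset (Fin n)}
    {F : Aggregator n d} {γ κ L ζ : ℝ} {T : ℕ} {θ : ℕ → Vec d} {g : ℕ → Fin n → Vec d}
    (hex : IsExecution Loss H (F ∘ arc f) γ T θ g) (hrob : IsRobust f κ F) (hκ : 0 ≤ κ)
    (hfn : 2 * f < n) (hH : H.card + f = n) (hγ : 0 ≤ γ) (hL : 0 ≤ L) (hζ0 : 0 ≤ ζ)
    (hs : ∀ i, LipschitzSmooth L (Loss i)) (hζ : ∀ i ∈ H, ‖gradient (Loss i) (θ 1)‖ ≤ ζ)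
    {t : ℕ} (ht : t < T) :
    ∀ i ∈ H, ‖gradient (Loss i) (θ (t + 1))‖ ≤ (1 + γ * L * √(1 + κ)) ^ t * ζ := by
  induction t with
  | zero => simpa using hζ
  | succ t ih =>
    intro i hi
    have ih' := ih (by omega)
    obtain ⟨hg, hstep⟩ := hex (t + 1) (Finset.mem_Icc.2 ⟨by omega, by omega⟩)
    set c := (1 + γ * L * √(1 + κ)) ^ t * ζ with hc
    have hc0 : 0 ≤ c := by positivity
    have harc : ∀ j ∈ H, ‖arc f (g (t + 1)) j‖ ≤ c := fun j _ =>
      norm_arc_le hfn hH (fun k hk => by rw [hg k hk]; exact ih' k hk) j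
    have hR : ‖(F ∘ arc f) (g (t + 1))‖ ≤ √(1 + κ) * c :=
      hrob.norm_le hκ hH (by omega) hc0 harc
    have h1 := hs i (θ (t + 1 + 1)) (θ (t + 1))
    rw [hstep, sub_sub_cancel_left, norm_neg, norm_smul, Real.norm_of_nonneg hγ, ← hstep] at h1
    have h2 := mul_le_mul_of_nonneg_left (mul_le_mul_of_nonneg_left hR hγ) hL
    have h3 := norm_sub_norm_le (gradient (Loss i) (θ (t + 1 + 1))) (gradient (Loss i) (θ (t + 1)))
    calc ‖gradient (Loss i) (θ (t + 1 + 1))‖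
        ≤ c + L * (γ * (√(1 + κ) * c)) := by linarith [ih' i hi]
      _ = (1 + γ * L * √(1 + κ)) ^ (t + 1) * ζ := by rw [hc]; ring

lemma IsExecution.norm_gradient_le_exp {Loss : Fin n → Vec d → ℝ} {H : Finset (Fin n)}
    {F : Aggregator n d} {γ κ L ζ : ℝ} {T : ℕ} {θ : ℕ → Vec d} {g : ℕ → Fin n → Vec d}
    (hex : IsExecution Loss H (F ∘ arc f) γ T θ g) (hrob : IsRobust f κ F) (hκ : 0 ≤ κ)
    (hfn : 2 * f < n) (hH : H.card + f = n) (hγ : 0 ≤ γ) (hL : 0 ≤ L) (hζ0 : 0 ≤ ζ)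
    (hs : ∀ i, LipschitzSmooth L (Loss i)) (hζ : ∀ i ∈ H, ‖gradient (Loss i) (θ 1)‖ ≤ ζ)
    {t : ℕ} (ht : t ∈ Finset.Icc 1 T) {i : Fin n} (hi : i ∈ H) :
    ‖gradient (Loss i) (θ t)‖ ≤ Real.exp (γ * T * L * √(1 + κ)) * ζ := by
  obtain ⟨s, rfl⟩ : ∃ s, t = s + 1 := ⟨t - 1, by rw [Finset.mem_Icc] at ht; omega⟩
  have hsT : s < T := by rw [Finset.mem_Icc] at ht; omega
  refine (hex.norm_gradient_le hrob hκ hfn hH hγ hL hζ0 hs hζ hsT i hi).trans ?_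
  refine mul_le_mul_of_nonneg_right ?_ hζ0
  have hx : 0 ≤ γ * L * √(1 + κ) := by positivity
  have hsT' : (s : ℝ) ≤ T := by exact_mod_cast hsT.le
  calc (1 + γ * L * √(1 + κ)) ^ s ≤ Real.exp (γ * L * √(1 + κ)) ^ s :=
        pow_le_pow_left₀ (by positivity) (by linarith [Real.add_one_le_exp (γ * L * √(1 + κ))]) s
    _ = Real.exp (s * (γ * L * √(1 + κ))) := (Real.exp_nat_mul _ _).symm
    _ ≤ Real.exp (γ * T * L * √(1 + κ)) := by
        rw [Real.exp_le_exp]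
        have := mul_le_mul_of_nonneg_right hsT' hx
        linarith

/-! ### Constants -/

lemma sqrt_one_add_div_le {κ : ℝ} (hκ : 0 < κ) : √(1 + κ) / κ ≤ 1 / κ + 2 := by
  have h : √(1 + κ) ≤ 1 + 2 * κ := by
    rw [Real.sqrt_le_left (by positivity)]
    nlinarith
  calc √(1 + κ) / κ ≤ (1 + 2 * κ) / κ := by gcongr
    _ = 1 / κ + 2 := by field_simp

/-- The total robustness cost of clipping and aggregation. With `r = f / (n - 2f)`, both bounds on
`κ` are dominated through `r = (f / n) (1 + 2 r) ≤ (f / n) (1 + r)²` and `f / (n - f) ≤ 2 f / n`. -/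
lemma three_mul_coefficient_le (hf : 0 < f) (hfn : 2 * f < n) {κ : ℝ}
    (hκ : κ ≤ max (48 * f / ((n : ℝ) - 2 * f)) (coefficientBound n f)) :
    3 * κ + 2 * f / ((n : ℝ) - 2 * f)
      ≤ 160 * ((f : ℝ) / n) * (1 + (f : ℝ) / ((n : ℝ) - 2 * f)) ^ 2 := by
  have hf0 : (0 : ℝ) < f := by exact_mod_cast hf
  have hfn' : (2 * f : ℝ) < n := by exact_mod_cast hfn
  have hN0 : (0 : ℝ) < (n : ℝ) - 2 * f := by linarith
  have hn0 : (0 : ℝ) < n := by linarith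
  set r : ℝ := (f : ℝ) / ((n : ℝ) - 2 * f) with hr
  set a : ℝ := (f : ℝ) / n with ha
  have hr0 : 0 < r := div_pos hf0 hN0
  have ha0 : 0 < a := div_pos hf0 hn0
  have hra : r = a * (1 + 2 * r) := by
    have h : r * ((n : ℝ) - 2 * f) = f := div_mul_cancel₀ _ hN0.ne'
    rw [ha, div_mul_eq_mul_div, eq_div_iff hn0.ne']
    linarith
  have hr1 : r ≤ a * (1 + r) ^ 2 := by nlinarith [mul_pos ha0 (pow_pos hr0 2)]
  have hp : (f : ℝ) / ((n : ℝ) - f) ≤ 2 * a := by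
    rw [ha, mul_div_assoc', div_le_div_iff₀ (by linarith) hn0]
    nlinarith
  have hbound : coefficientBound n f ≤ 32 * (a * (1 + r) ^ 2) := by
    rw [coefficientBound, ← hr, mul_div_assoc]
    have h1 : 1 + (1 + r) ^ 2 ≤ 2 * (1 + r) ^ 2 := by nlinarith
    calc 8 * ((f : ℝ) / ((n : ℝ) - f)) * (1 + (1 + r) ^ 2)
        ≤ 8 * (2 * a) * (2 * (1 + r) ^ 2) := by gcongr
      _ = _ := by ring
  have e1 : 48 * (f : ℝ) / ((n : ℝ) - 2 * f) = 48 * r := by rw [hr]; ring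
  have e2 : 2 * (f : ℝ) / ((n : ℝ) - 2 * f) = 2 * r := by rw [hr]; ring
  rw [e1] at hκ
  rw [e2]
  have hpos : 0 < a * (1 + r) ^ 2 := by positivity
  rcases le_max_iff.1 hκ with h | h <;> linarith

/-- The hypothesis on `ξ` turns the error of the algorithm into `υ` times the lower bound. -/
lemma error_le_mul_lowerBound {G B ρ υ ξ a : ℝ} (hG : 0 < G) (ha : 0 ≤ a)
    (hξ : 0 < ξ) (hξ' : ξ ≤ υ / Psi G B ρ) (haξ : a = (1 - ξ) * breakdownPoint B) :
    160 * a * (1 + 1 / B ^ 2) ^ 2 * (G ^ 2 + B ^ 2 * ρ ^ 2) ≤ υ * lowerBound G B a := by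
  have hΨ : 0 < Psi G B ρ := by unfold Psi; positivity
  have hden : 1 - (2 + B ^ 2) * a = ξ := by
    rw [haξ, breakdownPoint]
    field_simp
    ring
  have h1 : ξ * Psi G B ρ ≤ υ := (le_div_iff₀ hΨ).1 hξ'
  rw [lowerBound, hden]
  have h2 : υ * (1 / 4 * (G ^ 2 * a / ξ)) = υ * (G ^ 2 * a / 4) / ξ := by ring
  rw [h2, le_div_iff₀ hξ]
  have h3 := mul_le_mul_of_nonneg_right h1 (show 0 ≤ G ^ 2 * a / 4 by positivity)
  refine le_trans (le_of_eq ?_) h3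
  unfold Psi
  field_simp
  ring

end RobustDGD

end

/-! ### Convergence up to the lower bound -/

theorem mainTheorem2 {d n m f : ℕ} {Z : Type*} (hm : 0 < m)
    (ℓ : RobustDGD.Vec d → Z → ℝ) (D : Fin n → Fin m → Z)
    (Loss : Fin n → RobustDGD.Vec d → ℝ) (hLoss : ∀ i, Loss i = RobustDGD.localLoss ℓ (D i))
    (hℓ : ∀ z, Differentiable ℝ (fun θ => ℓ θ z))
    (L : ℝ) (hL : 0 < L) (hsmooth : ∀ i, RobustDGD.LipschitzSmooth L (Loss i))
    (H : Finset (Fin n)) (hH : H.card + f = n)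
    (G B : ℝ) (hG : 0 < G) (hB : 0 < B)
    (hdis : RobustDGD.GradientDissimilarity Loss H G B)
    (θ₁ : RobustDGD.Vec d)
    (Lstar : ℝ) (hLstar : IsGLB (Set.range (RobustDGD.honestLoss Loss H)) Lstar)
    (Δ₀ : ℝ) (hΔ : RobustDGD.honestLoss Loss H θ₁ - Lstar ≤ Δ₀)
    (ζ : ℝ) (hζ : ∀ i ∈ H, ‖gradient (Loss i) θ₁‖ ≤ ζ)
    (F : RobustDGD.Aggregator n d) (hF : RobustDGD.IsRuleWithNNM f F)
    (ξ₀ : ℝ) (hξ₀ : ξ₀ ∈ Set.Ioo (0 : ℝ) 1)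
    (υ : ℝ) (hυ : υ ∈ Set.Ioo (0 : ℝ) 1)
    (ξ : ℝ) (hξ : 0 < ξ)
    (hξ' : ξ ≤ min (υ / RobustDGD.Psi G B (RobustDGD.rhoConst G B L Δ₀ ξ₀ ζ)) ξ₀)
    (hf : (f : ℝ) / n = (1 - ξ) * RobustDGD.breakdownPoint B) :
    (∃ κ : ℝ, RobustDGD.IsRobustnessCoefficient f κ F) ∧
    ∀ (κ : ℝ), RobustDGD.IsRobustnessCoefficient f κ F →
      ∀ (T : ℕ), 1 ≤ T → Δ₀ * L / (κ * G ^ 2) ≤ T →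
      ∀ (γ : ℝ), γ = min (Δ₀ / (κ * G ^ 2) * (1 / T)) (1 / L) →
      ∀ (θ : ℕ → RobustDGD.Vec d) (g : ℕ → Fin n → RobustDGD.Vec d), θ 1 = θ₁ →
        RobustDGD.IsExecution Loss H (F ∘ RobustDGD.arc f) γ T θ g →
        RobustDGD.expectOutput T θ (fun x => ‖gradient (RobustDGD.honestLoss Loss H) x‖ ^ 2)
          ≤ υ * RobustDGD.lowerBound G B ((f : ℝ) / n) := by
  open RobustDGD in
  have hB2 : (0 : ℝ) < 2 + B ^ 2 := by positivity
  have hξ1 : ξ < 1 := (hξ'.trans (min_le_right _ _)).trans_lt hξ₀.2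
  have ha : (0 : ℝ) < (f : ℝ) / n := by
    rw [hf, breakdownPoint]
    exact mul_pos (by linarith) (by positivity)
  have hn0 : (0 : ℝ) < n := by
    rcases Nat.eq_zero_or_pos n with h | h
    · rw [h] at ha
      simp at ha
    · exact_mod_cast h
  have hf0' : (0 : ℝ) < f := by
    by_contra hcon
    exact absurd ha (not_lt.2 (div_nonpos_of_nonpos_of_nonneg (not_lt.1 hcon) hn0.le))
  have hf0 : 0 < f := by exact_mod_cast hf0'
  have hfB : (f : ℝ) * (2 + B ^ 2) = (1 - ξ) * n := by
    rw [breakdownPoint, div_eq_iff hn0.ne'] at hf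
    rw [hf]
    field_simp
  have hfn' : (2 * f : ℝ) < n := by
    have h1 : 0 < (f : ℝ) * B ^ 2 := by positivity
    have h2 : 0 < ξ * n := by positivity
    linarith
  have hfn : 2 * f < n := by exact_mod_cast hfn'
  have hN0 : (0 : ℝ) < (n : ℝ) - 2 * f := by linarith
  have hHc : 0 < H.card := by omega
  have hrob₀ := hF.isRobust hfn
  refine ⟨hrob₀.exists_isRobustnessCoefficient, ?_⟩
  intro κ hκ T hT hTκ γ hγ θ g hθ hex
  have hT0 : (0 : ℝ) < T := by exact_mod_cast hT
  set ρ := rhoConst G B L Δ₀ ξ₀ ζ with hρ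
  set h := honestLoss Loss H with hh
  have herr := error_le_mul_lowerBound (ρ := ρ) hG ha.le hξ (hξ'.trans (min_le_left _ _)) hf
  refine le_trans ?_ herr
  have htarget0 : 0 ≤ 160 * ((f : ℝ) / n) * (1 + 1 / B ^ 2) ^ 2 * (G ^ 2 + B ^ 2 * ρ ^ 2) := by
    positivity
  rw [expectOutput_eq]
  -- In dimension `0` every number is a robustness coefficient, but all gradients vanish.
  rcases Nat.eq_zero_or_pos d with rfl | hd
  · have : ∀ v : Vec 0, ‖v‖ = 0 := fun v => by rw [Subsingleton.elim v 0, norm_zero]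
    simpa [this] using htarget0
  have hκr := hκ.1.le_coefficient hf0 hfn
    (e := EuclideanSpace.single (⟨0, hd⟩ : Fin d) (1 : ℝ)) (by simp)
  have hr0 : 0 < (f : ℝ) / ((n : ℝ) - 2 * f) := div_pos hf0' hN0
  have hκ0 : 0 < κ := hr0.trans_le hκr
  have hcost := three_mul_coefficient_le hf0 hfn (hκ.2 _ hrob₀)
  have hdiff : ∀ i, Differentiable ℝ (Loss i) := fun i => by
    rw [hLoss]
    exact differentiable_localLoss hℓ _
  have hgrad : ∀ x, gradient h x = mean H fun i => gradient (Loss i) x := fun x =>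
    (hasGradientAt_honestLoss hdiff H x).gradient
  have hhd : Differentiable ℝ h := fun x =>
    (hasGradientAt_honestLoss hdiff H x).differentiableAt
  have hhs : LipschitzSmooth L h := lipschitzSmooth_honestLoss hdiff hL.le hsmooth H
  have hlow : ∀ y, Lstar ≤ h y := fun y => hLstar.1 (Set.mem_range_self y)
  have hΔ0 : 0 ≤ Δ₀ := by linarith [hlow θ₁]
  have hζ0 : 0 ≤ ζ := by
    obtain ⟨i, hi⟩ := Finset.card_pos.1 hHc
    exact (norm_nonneg _).trans (hζ i hi)
  have hκG : 0 < κ * G ^ 2 := by positivity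
  have hγT : γ = Δ₀ / (κ * G ^ 2) * (1 / T) := by
    rw [hγ]
    refine min_eq_left ?_
    rw [div_le_iff₀ hκG] at hTκ
    rw [div_mul_div_comm, mul_one, div_le_div_iff₀ (by positivity) hL]
    linarith
  have hγ0 : 0 ≤ γ := by rw [hγT]; positivity
  have hγL : γ * L ≤ 1 := by
    have : γ ≤ 1 / L := hγ ▸ min_le_right _ _
    rwa [le_div_iff₀ hL] at this
  have hγT' : γ * T = Δ₀ / (κ * G ^ 2) := by
    rw [hγT]
    field_simp
  -- The honest gradients stay below `ρ`.
  have hexp : γ * T * L * √(1 + κ) ≤ (2 + B ^ 2) * Δ₀ / ((1 - ξ₀) * G ^ 2) * L := by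
    have hξ₀1 : 0 < 1 - ξ₀ := by linarith [hξ₀.2]
    have h1 : 1 / κ + 2 ≤ (2 + B ^ 2) / (1 - ξ₀) := by
      have e1 : 1 / κ ≤ ((n : ℝ) - 2 * f) / f := by
        have := one_div_le_one_div_of_le hr0 hκr
        rwa [one_div_div] at this
      have e2 : ((n : ℝ) - 2 * f) / f + 2 = n / f := by field_simp; ring
      have e3 : (n : ℝ) / f ≤ (2 + B ^ 2) / (1 - ξ₀) := by
        rw [div_le_div_iff₀ hf0' hξ₀1]
        have := mul_le_mul_of_nonneg_left (hξ'.trans (min_le_right _ _)) hn0.le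
        linarith
      linarith
    have h2 := (sqrt_one_add_div_le hκ0).trans h1
    have h3 := mul_le_mul_of_nonneg_left h2 (show 0 ≤ Δ₀ / G ^ 2 * L by positivity)
    calc γ * T * L * √(1 + κ) = Δ₀ / G ^ 2 * L * (√(1 + κ) / κ) := by
          rw [hγT']
          field_simp
      _ ≤ _ := h3
      _ = _ := by field_simp
  have hbound : ∀ t ∈ Finset.Icc 1 T, ‖gradient h (θ t)‖ ≤ ρ := fun t ht => by
    rw [hgrad]
    refine norm_mean_le (by rw [hρ, rhoConst]; positivity) fun i hi => ?_
    refine (hex.norm_gradient_le_exp hκ.1 hκ0.le hfn hH hγ0 hL.le hζ0 hsmooth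
      (by rwa [hθ]) ht hi).trans ?_
    rw [hρ, rhoConst]
    exact mul_le_mul_of_nonneg_right (Real.exp_le_exp.2 hexp) hζ0
  set κ' : ℝ := κ + 2 * f / ((n : ℝ) - 2 * f) with hκ'
  have hκ'0 : 0 ≤ κ' := add_nonneg hκ0.le (div_nonneg (by positivity) hN0.le)
  have hE : ∀ t ∈ Finset.Icc 1 T, ‖(F ∘ arc f) (g t) - gradient h (θ t)‖ ^ 2
      ≤ κ' * (G ^ 2 + B ^ 2 * ρ ^ 2) := fun t ht => by
    have h1 := hκ.1.comp_arc hκ0.le hfn (g t) H hH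
    have hmean : mean H (g t) = gradient h (θ t) := by
      rw [hgrad, mean, mean, Finset.sum_congr rfl (hex t ht).1]
    rw [hmean, Finset.sum_congr rfl fun i hi => by rw [(hex t ht).1 i hi]] at h1
    have h2 := mul_le_mul_of_nonneg_left (hdis (θ t)) hκ'0
    have h3 := pow_le_pow_left₀ (norm_nonneg _) (hbound t ht) 2
    calc _ ≤ _ := h1
      _ = κ' * (1 / (H.card : ℝ) * ∑ i ∈ H, ‖gradient (Loss i) (θ t) - gradient h (θ t)‖ ^ 2) := by
          ring
      _ ≤ κ' * (G ^ 2 + B ^ 2 * ‖gradient h (θ t)‖ ^ 2) := h2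
      _ ≤ _ := by gcongr
  have havg : 1 / (T : ℝ) * ∑ t ∈ Finset.Icc 1 T, ‖gradient h (θ t)‖ ^ 2
      ≤ 2 * κ * G ^ 2 + κ' * (G ^ 2 + B ^ 2 * ρ ^ 2) := by
    rcases hΔ0.eq_or_lt with hΔ0' | hΔ0'
    · -- The step size vanishes, but the initial model is already a minimizer.
      have hγz : γ = 0 := by rw [hγT, ← hΔ0', zero_div, zero_mul]
      have hconst : ∀ s, s < T → θ (s + 1) = θ₁ := by
        intro s
        induction s with
        | zero => exact fun _ => hθ
        | succ s ih =>
          intro hs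
          rw [(hex (s + 1) (Finset.mem_Icc.2 ⟨by omega, by omega⟩)).2, hγz, zero_smul, sub_zero]
          exact ih (by omega)
      have hg1 : ‖gradient h θ₁‖ ^ 2 ≤ 0 := by
        refine (hhs.norm_gradient_sq_le hhd hL hlow θ₁).trans ?_
        exact mul_nonpos_of_nonneg_of_nonpos (by positivity) (by linarith)
      have hsum : ∑ t ∈ Finset.Icc 1 T, ‖gradient h (θ t)‖ ^ 2 ≤ 0 := by
        refine Finset.sum_nonpos fun t ht => ?_
        rw [Finset.mem_Icc] at ht
        have := hconst (t - 1) (by omega)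
        rw [Nat.sub_add_cancel ht.1] at this
        rwa [this]
      exact (mul_nonpos_of_nonneg_of_nonpos (by positivity) hsum).trans (by positivity)
    · have h1 := hhs.sum_norm_gradient_sq_le hhd hγ0 hγL (fun t ht => (hex t ht).2) hE
      have h2 := hlow (θ (T + 1))
      rw [hθ] at h1
      have hγpos : 0 < γ * T := by rw [hγT']; positivity
      have h3 : γ * T / 2 * (1 / (T : ℝ) * ∑ t ∈ Finset.Icc 1 T, ‖gradient h (θ t)‖ ^ 2)
          ≤ γ * T / 2 * (2 * κ * G ^ 2 + κ' * (G ^ 2 + B ^ 2 * ρ ^ 2)) := by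
        have e1 : γ * T / 2 * (1 / (T : ℝ) * ∑ t ∈ Finset.Icc 1 T, ‖gradient h (θ t)‖ ^ 2)
            = γ / 2 * ∑ t ∈ Finset.Icc 1 T, ‖gradient h (θ t)‖ ^ 2 := by field_simp
        have e2 : γ * T / 2 * (2 * κ * G ^ 2) = Δ₀ := by rw [hγT']; field_simp
        rw [e1, mul_add, e2]
        linarith
      exact le_of_mul_le_mul_left h3 (by positivity)
  refine havg.trans ?_
  have hw : 1 + (f : ℝ) / ((n : ℝ) - 2 * f) ≤ 1 + 1 / B ^ 2 := by
    have : (f : ℝ) / ((n : ℝ) - 2 * f) ≤ 1 / B ^ 2 := by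
      rw [div_le_div_iff₀ hN0 (by positivity)]
      have : 0 ≤ ξ * n := by positivity
      linarith
    linarith
  calc 2 * κ * G ^ 2 + κ' * (G ^ 2 + B ^ 2 * ρ ^ 2)
      ≤ (3 * κ + 2 * f / ((n : ℝ) - 2 * f)) * (G ^ 2 + B ^ 2 * ρ ^ 2) := by
        have : 0 ≤ 2 * κ * (B ^ 2 * ρ ^ 2) := by positivity
        rw [hκ']
        linarith
    _ ≤ 160 * ((f : ℝ) / n) * (1 + (f : ℝ) / ((n : ℝ) - 2 * f)) ^ 2
          * (G ^ 2 + B ^ 2 * ρ ^ 2) := by gcongr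
    _ ≤ _ := by gcongr
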